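/- **Setting.** Let $G_1,\dots,G_r$ be a partition of $[n]=\{1,\dots,n\}$ into blocks, let $M$ be an $m\times n$ real matrix with non-negative entries, let $y\in[0,1]^n$ satisfy $y(G_i)=1$ for every $i\in[r]$ (where $z(X)=\sum_{j\in X}z_j$), and let $t$ be an integer with $t>12m$. For $z\in[0,1]^n$ and $X\subseteq[n]$ let $\mathrm{frac}(X,z)=\{j\in X: z_j\notin\{0,1\}\}$, $T(z,i)=\max(0,|\mathrm{frac}(G_i,z)|-1)$ and $T(z)=\sum_{i=1}^r T(z,i)$. The random vector $Y=\textsc{FullKPR}(G_i,M,y,t)\in\{0,1\}^n$ is generated as follows. 1. For $i=1,\dots,r$ in turn, replace $y$ by a random extreme point $y'$ of the polytope $\{y'\in[0,1]^n: My'=My,\ y'(G_i)=1,\ y'_j=y_j\text{ for }j\notin G_i\}$ such that $\mathbf E[y']=y$ (given the current $y$). 2. While $T(y)>t$, perform the following iteration. Form $J\subseteq[r]$ by putting each $i\in[r]$ into $J$ independently with probability $3m/T(y)$. If $\sum_{i\in J}T(y,i)\ge m+1$, choose $\delta'\in\mathbb R^n$ such that $M\delta'=0$; $y+\delta',\,y-\delta'\in[0,1]^n$;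 some $j\in\mathrm{frac}([n],y)$ has $y_j+\delta'_j\in\{0,1\}$ or $y_j-\delta'_j\in\{0,1\}$; $\delta'_j=0$ for all $j\in G_i$ with $i\notin J$; and $\delta'(G_i)=0$ for all $i\in[r]$. Then replace $y$ by $y+\delta'$ or $y-\delta'$, with probability $1/2$ each. (If $\sum_{i\in J}T(y,i)\leq m$, leave $y$ unchanged.) 3. Let $y'$ be the resulting vector. Independently for each block $G_i$ select one item $Z_i\in G_i$ with $\Pr(Z_i=j)=y'_j$, and set $Y_j=1$ if $j$ is selected and $Y_j=0$ otherwise. **Theorem (lower tail concentration for FullKPR).** There is an absolute constant $C>0$ such that the following holds for all $n,r,m,t,G_i,M,y$ as above, and for every (possibly randomized) way of making the choices left open in steps 1 and 2. The procedure ends with probability one, so that $Y$ is well defined; and if $w\in[0,1]^n$ satisfies $y\cdot w=\sum_j y_jw_j\ge\mu$ for a real number $\mu\ge1$, where $y$ is the given initial vector, then for every $\delta\in[0,1]$ $$\Pr\bigl(Y\cdot w\le\mu(1-\delta)\bigr)\ \le\ e^{C m^2(1+\delta\mu)^3/t}\left(\frac{e^{-\delta}}{(1-\delta)^{1-\delta}}\right)^{\mu},$$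 with the convention $0^0=1$ for $\delta=1$. -/

import Mathlib

open scoped ENNReal NNReal

noncomputable section

namespace KPR

variable {n r m : ℕ}

/-- `G 0, …, G (r - 1)` partition the ground set `Fin n`. -/
def IsPartition (G : Fin r → Finset (Fin n)) : Prop :=
  ∀ j : Fin n, ∃! i : Fin r, j ∈ G i

/-- The fractional vectors of a partition system: `z ∈ [0,1]^n` and `z(G i) = 1` for all `i`. -/
def Feasible (G : Fin r → Finset (Fin n)) : Set (Fin n → ℝ) :=
  {z | (∀ j, 0 ≤ z j ∧ z j ≤ 1) ∧ ∀ i, ∑ j ∈ G i, z j = 1}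

/-- `frac(X, z)`: the entries of `X` at which `z` is not `0` or `1`. -/
def frac (X : Finset (Fin n)) (z : Fin n → ℝ) : Finset (Fin n) := by
  classical exact X.filter fun j => z j ≠ 0 ∧ z j ≠ 1

/-- `T(z, i) = max(0, |frac(G i, z)| - 1)` (the subtraction in `ℕ` is truncated at `0`). -/
def blockT (G : Fin r → Finset (Fin n)) (z : Fin n → ℝ) (i : Fin r) : ℕ :=
  (frac (G i) z).card - 1

/-- `T(z) = ∑ i, T(z, i)`. -/
def totalT (G : Fin r → Finset (Fin n)) (z : Fin n → ℝ) : ℕ :=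
  ∑ i, blockT G z i

/-- The polytope of the vectors `z ∈ [0,1]^n` with `M z = M y`, `z(G i) = 1`, and `z = y`
outside the block `G i`. -/
def blockPolytope (G : Fin r → Finset (Fin n)) (M : Matrix (Fin m) (Fin n) ℝ)
    (i : Fin r) (y : Fin n → ℝ) : Set (Fin n → ℝ) :=
  {z | (∀ j, 0 ≤ z j ∧ z j ≤ 1) ∧ M.mulVec z = M.mulVec y ∧ ∑ j ∈ G i, z j = 1 ∧
    ∀ j, j ∉ G i → z j = y j}

/-- `p` is an admissible law for the random vector that replaces `y` when the block `G i` is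
reduced: it has mean `y` and is supported on the extreme points of the polytope. -/
structure IsBlockReduction (G : Fin r → Finset (Fin n)) (M : Matrix (Fin m) (Fin n) ℝ)
    (i : Fin r) (y : Fin n → ℝ) (p : PMF (Fin n → ℝ)) : Prop where
  extreme : ∀ z ∈ p.support, z ∈ (blockPolytope G M i y).extremePoints ℝ
  mean : ∀ j, HasSum (fun z : Fin n → ℝ => (p z).toReal * z j) (y j)

/-- `δ` is an admissible modification vector at the current vector `z`, for the sampled set `J` of
blocks. -/
structure IsDirection (G : Fin r → Finset (Fin n)) (M : Matrix (Fin m) (Fin n) ℝ)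
    (z : Fin n → ℝ) (J : Finset (Fin r)) (δ : Fin n → ℝ) : Prop where
  knapsack : M.mulVec δ = 0
  add_mem : ∀ j, 0 ≤ z j + δ j ∧ z j + δ j ≤ 1
  sub_mem : ∀ j, 0 ≤ z j - δ j ∧ z j - δ j ≤ 1
  rounds : ∃ j ∈ frac Finset.univ z,
    (z j + δ j = 0 ∨ z j + δ j = 1) ∨ (z j - δ j = 0 ∨ z j - δ j = 1)
  off : ∀ i, i ∉ J → ∀ j ∈ G i, δ j = 0
  block : ∀ i, ∑ j ∈ G i, δ j = 0

/-- An implementation of the steps that the algorithm leaves open: the law of the reduced vector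
for each block and current vector, and the law of the modification vector `δ` for each round
of the main loop, current vector and sampled set `J` of blocks (in the case where `δ` is used).
The choices may be randomized.  Letting them depend also on the history of the run gives no further
laws for the output, as averaging over the histories that lead to a given current vector yields an
implementation as below. -/
structure Implementation (G : Fin r → Finset (Fin n)) (M : Matrix (Fin m) (Fin n) ℝ) where
  reduce : Fin r → (Fin n → ℝ) → PMF (Fin n → ℝ)
  dir : ℕ → (Fin n → ℝ) → Finset (Fin r) → PMF (Fin n → ℝ)
  reduce_spec : ∀ i, ∀ z ∈ Feasible G, IsBlockReduction G M i z (reduce i z)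
  dir_spec : ∀ k, ∀ z ∈ Feasible G, ∀ J : Finset (Fin r), m + 1 ≤ ∑ i ∈ J, blockT G z i →
    ∀ δ ∈ (dir k z J).support, IsDirection G M z J δ

/-- The law of a random `J ⊆ Fin r` that contains each index independently with
probability `p`. -/
def randomSubset (r : ℕ) (p : ℝ≥0) (hp : p ≤ 1) : PMF (Finset (Fin r)) :=
  PMF.ofFintype (fun J => ((p ^ J.card * (1 - p) ^ (r - J.card) : ℝ≥0) : ℝ≥0∞)) (by
    rw [← ENNReal.ofNNReal_finsetSum, ← Finset.powerset_univ]
    have h := Finset.sum_pow_mul_eq_add_pow p (1 - p) (Finset.univ : Finset (Fin r))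
    rw [Finset.card_univ, Fintype.card_fin] at h
    rw [h, add_tsub_cancel_of_le hp, one_pow, ENNReal.coe_one])

/-- The sampling probability `3 m / T(z)`, capped at `1`.  The main loop uses it only for
`T(z) > t > 12 m`, where it is at most `1 / 4` and the cap plays no role. -/
def sampleProb (m T : ℕ) : ℝ≥0 := min (3 * m / T) 1

/-- The law of the vector returned by one KPR iteration at `z`, where `d J` is the law of the
modification vector for the sampled set `J`. -/
def iteration (G : Fin r → Finset (Fin n)) (m : ℕ)
    (d : Finset (Fin r) → PMF (Fin n → ℝ)) (z : Fin n → ℝ) : PMF (Fin n → ℝ) :=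
  (randomSubset r (sampleProb m (totalT G z)) (min_le_right _ _)).bind fun J =>
    if m + 1 ≤ ∑ i ∈ J, blockT G z i then
      (d J).bind fun δ =>
        (PMF.uniformOfFintype Bool).bind fun b => PMF.pure (if b then z + δ else z - δ)
    else PMF.pure z

/-- The law of the vector after the blocks have been reduced one after the other. -/
def intraBlockReduce {G : Fin r → Finset (Fin n)} {M : Matrix (Fin m) (Fin n) ℝ}
    (A : Implementation G M) (y : Fin n → ℝ) : PMF (Fin n → ℝ) :=
  (List.finRange r).foldl (fun p i => p.bind (A.reduce i)) (PMF.pure y)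

/-- The law of the vector after `k` rounds of the loop "while `T(z) > t`, apply a KPR iteration",
where a run that has left the loop keeps its vector. -/
def loopLaw {G : Fin r → Finset (Fin n)} {M : Matrix (Fin m) (Fin n) ℝ}
    (A : Implementation G M) (y : Fin n → ℝ) (t : ℕ) : ℕ → PMF (Fin n → ℝ)
  | 0 => intraBlockReduce A y
  | k + 1 => (loopLaw A y t k).bind fun z =>
      if t < totalT G z then iteration G m (A.dir k z) z else PMF.pure z

/-- The law of the output of KPR: the probability that the loop ends with the vector `z`.  (For
`T(z) ≤ t`, the probability of having ended with `z` within `k` rounds is non-decreasing in `k`.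
The mass missing from `1`, if any, is the probability that the loop never ends.) -/
def kpr {G : Fin r → Finset (Fin n)} {M : Matrix (Fin m) (Fin n) ℝ}
    (A : Implementation G M) (y : Fin n → ℝ) (t : ℕ) (z : Fin n → ℝ) : ℝ≥0∞ :=
  if totalT G z ≤ t then ⨆ k, loopLaw A y t k z else 0

/-- The indicator vector of the items selected by `s`. -/
def selected (s : Fin r → Fin n) : Fin n → ℝ := by
  classical exact fun j => if ∃ i, s i = j then 1 else 0

/-- Independent selection with respect to `z`: independently for each block `i`, an item
`s i ∈ G i` is selected, with probability `z (s i)`; this is the probability that the resulting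
indicator vector is `Y`. -/
def indSelect (G : Fin r → Finset (Fin n)) (z Y : Fin n → ℝ) : ℝ≥0∞ := by
  classical exact
    ∑ s ∈ Fintype.piFinset G, if selected s = Y then ∏ i, ENNReal.ofReal (z (s i)) else 0

/-- The law of the output of FullKPR: independent selection with respect to the output of KPR. -/
def fullKPR {G : Fin r → Finset (Fin n)} {M : Matrix (Fin m) (Fin n) ℝ}
    (A : Implementation G M) (y : Fin n → ℝ) (t : ℕ) (Y : Fin n → ℝ) : ℝ≥0∞ :=
  ∑' z : Fin n → ℝ, kpr A y t z * indSelect G z Y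

/-- The probability of the event `E` under a discrete law given by its point masses. -/
def prob (law : (Fin n → ℝ) → ℝ≥0∞) (E : Set (Fin n → ℝ)) : ℝ≥0∞ :=
  ∑' Y : Fin n → ℝ, E.indicator law Y

end KPR

end

open scoped ENNReal NNReal

noncomputable section

namespace KPR

/-! Write `d` for the tail parameter, `X = d (y ⬝ᵥ w)` and `Φ` for `potential`. Bernoulli's
inequality `(1-d)^a ≤ 1 - d a` on `[0,1]` shows that independent selection from `z` satisfies `E
(1-d)^(Y·w) ≤ Φ(z)`, and Markov's inequality turns this into the tail bound
(`tsum_indicator_indSelect_le`). Since `Φ(y) ≤ e^{-X}`, it remains to see that KPR increases the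
mean of `Φ` beyond `e^{-X}` by at most the error factor (`tsum_kpr_mul_potential_le`).

Block reduction preserves the mean of `Φ`, as `Φ` is affine in each block, and its extreme points
leave at most `m + 1` fractional entries per block. In the main loop the random sign cancels odd
terms: averaging over the sign and over `J` multiplies `Φ` by at most `1 + u² e^u / 2`, where `u =
(6m/T) d (z ⬝ᵥ w)` (`sum_subsetWeight_even_le`).

This growth is paid for by progress. With probability at least `1/4` the sample `J` is large enough
to move, and then one of the two signs lowers `T`. The factor `levelWeight`, a product of terms `1 +
K/s²` over levels `s > t`, falls at each such drop yet never exceeds `e^{K/t}`. The sign that rounds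
might have small `Φ`, so `Φ` there is bounded from below. Where `d (z ⬝ᵥ w)` is large this gain may
vanish, but `Φ` is then exponentially small and an additive constant `ε` covers the loss. Thus `(Φ +
ε) * levelWeight` is a supermartingale (`potential_increment_le`,
`expect_weightedPotential_iteration_le`). Taking `ε = e^{-(1+X)}` and subtracting it at the end
loses no constant factor. If `t` is too small for this argument, the error factor already exceeds
`e^X`.

Termination follows from the constant negative drift of `T`, which is bounded by `r * m`. -/

/-! ### Expectations under discrete laws -/

/-- The expectation of a non-negative function under a discrete law. -/
def expect {α : Type*} (p : PMF α) (f : α → ℝ≥0∞) : ℝ≥0∞ := ∑' a, p a * f a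

theorem expect_pure {α : Type*} (a : α) (f : α → ℝ≥0∞) : expect (PMF.pure a) f = f a := by
  classical
  simp [expect, PMF.pure_apply]

theorem expect_bind {α β : Type*} (p : PMF α) (q : α → PMF β) (f : β → ℝ≥0∞) :
    expect (p.bind q) f = expect p fun a => expect (q a) f := by
  simp only [expect, PMF.bind_apply, ← ENNReal.tsum_mul_right, ← ENNReal.tsum_mul_left]
  rw [ENNReal.tsum_comm]
  simp only [mul_assoc]

theorem expect_mono {α : Type*} {p : PMF α} {f g : α → ℝ≥0∞} (h : ∀ a ∈ p.support, f a ≤ g a) :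
    expect p f ≤ expect p g := by
  refine ENNReal.tsum_le_tsum fun a => ?_
  by_cases ha : p a = 0
  · simp [ha]
  · exact mul_le_mul_right (h a ((p.mem_support_iff a).2 ha)) _

theorem expect_const {α : Type*} (p : PMF α) (c : ℝ≥0∞) : expect p (fun _ => c) = c := by
  simp [expect, ENNReal.tsum_mul_right, p.tsum_coe]

theorem expect_le_const {α : Type*} {p : PMF α} {f : α → ℝ≥0∞} {c : ℝ≥0∞}
    (h : ∀ a ∈ p.support, f a ≤ c) : expect p f ≤ c :=
  (expect_mono h).trans_eq (expect_const p c)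

theorem expect_mul_const {α : Type*} (p : PMF α) (f : α → ℝ≥0∞) (c : ℝ≥0∞) :
    expect p (fun a => f a * c) = expect p f * c := by
  simp only [expect, ← mul_assoc, ENNReal.tsum_mul_right]

theorem expect_add {α : Type*} (p : PMF α) (f g : α → ℝ≥0∞) :
    expect p (fun a => f a + g a) = expect p f + expect p g := by
  simp only [expect, mul_add, ENNReal.tsum_add]

theorem expect_fintype {α : Type*} [Fintype α] (p : PMF α) (f : α → ℝ≥0∞) :
    expect p f = ∑ a, p a * f a := tsum_fintype _

theorem tsum_iSup_of_monotone {α : Type*} (f : ℕ → α → ℝ≥0∞) (hf : ∀ a, Monotone fun k => f k a) :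
    ∑' a, ⨆ k, f k a = ⨆ k, ∑' a, f k a := by
  simp only [ENNReal.tsum_eq_iSup_sum]
  rw [iSup_comm]
  exact iSup_congr fun s => ENNReal.finsetSum_iSup_of_monotone hf

/-! ### Product inequalities -/

/-- The even part of a product. -/
theorem abs_prod_add_prod_sub_le {ι : Type*} (s : Finset ι) (a b ρ : ι → ℝ)
    (ha : ∀ i ∈ s, 0 ≤ a i) (hb : ∀ i ∈ s, |b i| ≤ ρ i * a i) (hρ : ∀ i ∈ s, 0 ≤ ρ i) :
    |∏ i ∈ s, (a i + b i) + ∏ i ∈ s, (a i - b i)| ≤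
        (∏ i ∈ s, a i) * (∏ i ∈ s, (1 + ρ i) + ∏ i ∈ s, (1 - ρ i)) ∧
      |∏ i ∈ s, (a i + b i) - ∏ i ∈ s, (a i - b i)| ≤
        (∏ i ∈ s, a i) * (∏ i ∈ s, (1 + ρ i) - ∏ i ∈ s, (1 - ρ i)) := by
  classical
  induction s using Finset.induction_on with
  | empty => simp; norm_num
  | insert i s hi ih =>
    obtain ⟨h1, h2⟩ := ih (fun k hk => ha k (Finset.mem_insert_of_mem hk))
      (fun k hk => hb k (Finset.mem_insert_of_mem hk))
      (fun k hk => hρ k (Finset.mem_insert_of_mem hk))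
    have hai := ha i (Finset.mem_insert_self i s)
    have hbi := hb i (Finset.mem_insert_self i s)
    have hρi := hρ i (Finset.mem_insert_self i s)
    simp only [Finset.prod_insert hi]
    set P := ∏ i ∈ s, (a i + b i)
    set Q := ∏ i ∈ s, (a i - b i)
    set A := ∏ i ∈ s, a i
    set U := ∏ i ∈ s, (1 + ρ i)
    set W := ∏ i ∈ s, (1 - ρ i)
    -- A new factor couples the parities: the even part becomes `a i * even + b i * odd`, and the
    -- odd part `a i * odd + b i * even`. Hence both bounds go through one induction.
    have key : ∀ x y X Y : ℝ, |x| ≤ A * X → |y| ≤ A * Y →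
        |a i * x + b i * y| ≤ a i * A * (X + ρ i * Y) := by
      intro x y X Y hx hy
      calc |a i * x + b i * y| ≤ |a i * x| + |b i * y| := abs_add_le _ _
        _ = a i * |x| + |b i| * |y| := by rw [abs_mul, abs_mul, abs_of_nonneg hai]
        _ ≤ a i * (A * X) + (ρ i * a i) * (A * Y) := by
            gcongr
        _ = _ := by ring
    constructor
    · convert key _ _ _ _ h1 h2 using 2 <;> ring
    · convert key _ _ _ _ h2 h1 using 2 <;> ring

/-- Truncation at `1` keeps the factors nonnegative: where `ρ i ≥ 1` the left factor is `0` and only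
`0 ≤ a i + b i` is needed. -/
theorem prod_mul_prod_one_sub_min_le {ι : Type*} (s : Finset ι) (a b ρ : ι → ℝ)
    (ha : ∀ i ∈ s, 0 ≤ a i) (hab : ∀ i ∈ s, 0 ≤ a i + b i) (hb : ∀ i ∈ s, |b i| ≤ ρ i * a i) :
    (∏ i ∈ s, a i) * ∏ i ∈ s, (1 - min 1 (ρ i)) ≤ ∏ i ∈ s, (a i + b i) := by
  rw [← Finset.prod_mul_distrib]
  refine Finset.prod_le_prod (fun i hi => mul_nonneg (ha i hi) ?_) fun i hi => ?_
  · linarith [min_le_left 1 (ρ i)]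
  · rcases le_total 1 (ρ i) with h | h
    · rw [min_eq_left h]; simpa using hab i hi
    · rw [min_eq_right h]
      nlinarith [neg_abs_le (b i), hb i hi]

theorem one_sub_sum_le_prod_one_sub {ι : Type*} (s : Finset ι) (x : ι → ℝ)
    (h0 : ∀ i ∈ s, 0 ≤ x i) (h1 : ∀ i ∈ s, x i ≤ 1) :
    1 - ∑ i ∈ s, x i ≤ ∏ i ∈ s, (1 - x i) := by
  classical
  induction s using Finset.induction_on with
  | empty => simp
  | insert i s hi ih =>
    have ih := ih (fun k hk => h0 k (Finset.mem_insert_of_mem hk))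
      (fun k hk => h1 k (Finset.mem_insert_of_mem hk))
    rw [Finset.prod_insert hi, Finset.sum_insert hi]
    have h0i := h0 i (Finset.mem_insert_self i s)
    have h1i := h1 i (Finset.mem_insert_self i s)
    have hs : 0 ≤ ∑ k ∈ s, x k := Finset.sum_nonneg fun k hk => h0 k (Finset.mem_insert_of_mem hk)
    nlinarith [mul_le_mul_of_nonneg_left ih (sub_nonneg.2 h1i), mul_nonneg h0i hs]

theorem prod_one_add_le_exp_sum {ι : Type*} (s : Finset ι) (x : ι → ℝ)
    (h : ∀ i ∈ s, -1 ≤ x i) : ∏ i ∈ s, (1 + x i) ≤ Real.exp (∑ i ∈ s, x i) := by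
  rw [Real.exp_sum]
  exact Finset.prod_le_prod (fun i hi => by linarith [h i hi])
    fun i _ => by linarith [Real.add_one_le_exp (x i)]

/-- The excess `e^u + e^{-u} - 2` equals `e^u (1 - e^{-u})²`, and `0 ≤ 1 - e^{-u} ≤ u`. -/
theorem exp_add_exp_neg_le (u : ℝ) (hu : 0 ≤ u) :
    Real.exp u + Real.exp (-u) ≤ 2 + u ^ 2 * Real.exp u := by
  have h1 : 1 - Real.exp (-u) ≤ u := by linarith [Real.add_one_le_exp (-u)]
  have h2 : 0 ≤ 1 - Real.exp (-u) := by
    have : Real.exp (-u) ≤ 1 := Real.exp_le_one_iff.2 (by linarith)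
    linarith
  have h3 : Real.exp u * Real.exp (-u) = 1 := by rw [← Real.exp_add]; simp
  have h4 : (1 - Real.exp (-u)) ^ 2 ≤ u ^ 2 := by gcongr
  have h5 := mul_le_mul_of_nonneg_left h4 (Real.exp_pos u).le
  have h6 : Real.exp u * (1 - Real.exp (-u)) ^ 2 =
      Real.exp u - 2 * (Real.exp u * Real.exp (-u)) +
        Real.exp u * Real.exp (-u) * Real.exp (-u) := by ring
  rw [h6, h3] at h5
  linarith

/-! ### Random subsets -/

/-- The probability of `J` when each index is sampled independently with probability `p`. -/
def subsetWeight {r : ℕ} (p : ℝ) (J : Finset (Fin r)) : ℝ := p ^ J.card * (1 - p) ^ (r - J.card)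

theorem subsetWeight_nonneg {r : ℕ} {p : ℝ} (h0 : 0 ≤ p) (h1 : p ≤ 1) (J : Finset (Fin r)) :
    0 ≤ subsetWeight p J :=
  mul_nonneg (pow_nonneg h0 _) (pow_nonneg (by linarith) _)

theorem randomSubset_apply {r : ℕ} (p : ℝ≥0) (hp : p ≤ 1) (J : Finset (Fin r)) :
    randomSubset r p hp J = ENNReal.ofReal (subsetWeight (p : ℝ) J) := by
  have h : subsetWeight (p : ℝ) J = ((p ^ J.card * (1 - p) ^ (r - J.card) : ℝ≥0) : ℝ) := by
    simp [subsetWeight, NNReal.coe_sub hp]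
  rw [h, ENNReal.ofReal_coe_nnreal]
  rfl

/-- Independence of the samples: every average over `J` of a product becomes a product over all
blocks. -/
theorem sum_subsetWeight_mul_prod {r : ℕ} (p : ℝ) (c : Fin r → ℝ) :
    ∑ J : Finset (Fin r), subsetWeight p J * ∏ i ∈ J, c i = ∏ i, (1 - p + p * c i) := by
  have h := Finset.prod_add (fun i => p * c i) (fun _ => 1 - p) (Finset.univ : Finset (Fin r))
  simp only [add_comm (1 - p)]
  rw [h, Finset.powerset_univ]
  refine Finset.sum_congr rfl fun J _ => ?_
  rw [Finset.prod_mul_distrib, Finset.prod_const, Finset.prod_const, subsetWeight,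
    Finset.card_sdiff_of_subset (Finset.subset_univ J), Finset.card_univ, Fintype.card_fin]
  ring

theorem sum_subsetWeight {r : ℕ} (p : ℝ) : ∑ J : Finset (Fin r), subsetWeight p J = 1 := by
  simpa using sum_subsetWeight_mul_prod p (fun _ : Fin r => (1 : ℝ))

theorem exp_neg_le_one_sub_half {x : ℝ} (h0 : 0 ≤ x) (h1 : x ≤ 1) :
    Real.exp (-x) ≤ 1 - x / 2 := by
  have h2 : Real.exp x * Real.exp (-x) = 1 := by rw [← Real.exp_add]; simp
  nlinarith [Real.add_one_le_exp x, Real.exp_pos (-x), mul_nonneg h0 (sub_nonneg.2 h1)]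

/-- A random set of blocks of total size `3 m` on average rarely has total size at most `m`. -/
theorem sum_subsetWeight_small_le {r m : ℕ} {p : ℝ} (h0 : 0 ≤ p) (h1 : p ≤ 1) (hm : 0 < m)
    (T : Fin r → ℕ) (hT : ∀ i, T i ≤ m) (hp : p * (∑ i, T i : ℕ) = 3 * m) :
    ∑ J : Finset (Fin r), subsetWeight p J * (if m + 1 ≤ ∑ i ∈ J, T i then 0 else 1) ≤ 3 / 4 := by
  have hm' : (0 : ℝ) < m := by exact_mod_cast hm
  have hx0 : ∀ i, 0 ≤ (T i : ℝ) / m := fun i => by positivity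
  have hx1 : ∀ i, (T i : ℝ) / m ≤ 1 := fun i => by
    rw [div_le_one hm']; exact_mod_cast hT i
  -- Exponential Markov: the indicator is at most `exp (1 - ∑ i ∈ J, T i / m)`. As `T i ≤ m`, the
  -- chord bound `e^{-x} ≤ 1 - x/2` applies, and the mean is at most `e^{1 - 3/2}`.
  calc ∑ J : Finset (Fin r), subsetWeight p J * (if m + 1 ≤ ∑ i ∈ J, T i then 0 else 1)
      ≤ ∑ J : Finset (Fin r), subsetWeight p J *
          (Real.exp 1 * ∏ i ∈ J, Real.exp (-((T i : ℝ) / m))) := by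
        refine Finset.sum_le_sum fun J _ => mul_le_mul_of_nonneg_left ?_
          (subsetWeight_nonneg h0 h1 J)
        rw [← Real.exp_sum, ← Real.exp_add]
        split_ifs with h
        · positivity
        · apply Real.one_le_exp
          rw [Finset.sum_neg_distrib, ← Finset.sum_div]
          have : ((∑ i ∈ J, (T i : ℝ)) : ℝ) ≤ m := by
            have : ∑ i ∈ J, T i ≤ m := by omega
            exact_mod_cast this
          have := (div_le_one hm').2 this
          linarith
    _ = Real.exp 1 * ∏ i, (1 + -(p * (1 - Real.exp (-((T i : ℝ) / m))))) := by
        simp only [mul_left_comm _ (Real.exp 1)]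
        rw [← Finset.mul_sum, sum_subsetWeight_mul_prod]
        congr 1
        exact Finset.prod_congr rfl fun i _ => by ring
    _ ≤ Real.exp 1 * Real.exp (∑ i, -(p * (1 - Real.exp (-((T i : ℝ) / m))))) := by
        gcongr
        refine prod_one_add_le_exp_sum _ _ fun i _ => ?_
        nlinarith [Real.exp_pos (-((T i : ℝ) / m))]
    _ ≤ Real.exp 1 * Real.exp (∑ i, -(p * ((T i : ℝ) / m / 2))) := by
        gcongr with i
        linarith [exp_neg_le_one_sub_half (hx0 i) (hx1 i)]
    _ = Real.exp (-(1 / 2)) := by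
        rw [← Real.exp_add, Finset.sum_neg_distrib, ← Finset.mul_sum, ← Finset.sum_div,
          ← Finset.sum_div]
        push_cast at hp
        congr 1
        field_simp
        linarith
    _ ≤ 3 / 4 := by
        have := exp_neg_le_one_sub_half (x := 1 / 2) (by norm_num) (by norm_num)
        linarith

/-! ### Feasible vectors, their fractional entries, and modification vectors -/

section Feasible

variable {n r m : ℕ} {G : Fin r → Finset (Fin n)} {M : Matrix (Fin m) (Fin n) ℝ}
  {z δ : Fin n → ℝ} {J : Finset (Fin r)}

theorem mem_frac {X : Finset (Fin n)} {j : Fin n} :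
    j ∈ frac X z ↔ j ∈ X ∧ z j ≠ 0 ∧ z j ≠ 1 := by
  simp [frac]

theorem IsPartition.eq_of_mem (hG : IsPartition G) {j : Fin n} {i k : Fin r} (hi : j ∈ G i)
    (hk : j ∈ G k) : i = k :=
  (hG j).unique hi hk

theorem IsPartition.sum_sum (hG : IsPartition G) (f : Fin n → ℝ) :
    ∑ i, ∑ j ∈ G i, f j = ∑ j, f j := by
  classical
  rw [← Finset.sum_biUnion]
  · congr 1
    ext j
    simpa using (hG j).exists
  · intro i _ k _ hik
    exact Finset.disjoint_left.2 fun j hi hk => hik (hG.eq_of_mem hi hk)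

theorem IsDirection.neg (h : IsDirection G M z J δ) : IsDirection G M z J (-δ) where
  knapsack := by rw [Matrix.mulVec_neg, h.knapsack, neg_zero]
  add_mem j := by simpa [← sub_eq_add_neg] using h.sub_mem j
  sub_mem j := by simpa using h.add_mem j
  rounds := by
    obtain ⟨j, hj, h⟩ := h.rounds
    exact ⟨j, hj, by simpa [← sub_eq_add_neg] using h.symm⟩
  off i hi j hj := by simpa using h.off i hi j hj
  block i := by simpa using h.block i

theorem IsDirection.add_feasible (h : IsDirection G M z J δ) (hz : z ∈ Feasible G) :
    z + δ ∈ Feasible G :=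
  ⟨h.add_mem, fun i => by simp [Finset.sum_add_distrib, hz.2 i, h.block i]⟩

theorem IsDirection.sub_feasible (h : IsDirection G M z J δ) (hz : z ∈ Feasible G) :
    z - δ ∈ Feasible G := by
  rw [sub_eq_add_neg]
  exact h.neg.add_feasible hz

/-- At an integral entry, both signs staying in `[0,1]` forces `δ j = 0`, so integral entries are
never disturbed. -/
theorem IsDirection.frac_add_subset (h : IsDirection G M z J δ) (X : Finset (Fin n)) :
    frac X (z + δ) ⊆ frac X z := by
  intro j hj
  rw [mem_frac] at hj ⊢
  have h1 := h.add_mem j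
  have h2 := h.sub_mem j
  have h3 : ∀ c, z j = c → δ j = 0 → z j + δ j = c := fun c hc h0 => by rw [hc, h0, add_zero]
  refine ⟨hj.1, fun h0 => hj.2.1 (h3 _ h0 ?_), fun h0 => hj.2.2 (h3 _ h0 ?_)⟩ <;> linarith

theorem IsDirection.blockT_add_le (h : IsDirection G M z J δ) (i : Fin r) :
    blockT G (z + δ) i ≤ blockT G z i :=
  Nat.sub_le_sub_right (Finset.card_le_card (h.frac_add_subset _)) 1

theorem IsDirection.totalT_add_le (h : IsDirection G M z J δ) : totalT G (z + δ) ≤ totalT G z :=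
  Finset.sum_le_sum fun i _ => h.blockT_add_le i

/-- A block sums to `1`, so it cannot have exactly one fractional entry. Hence the truncated
subtraction in `blockT` does not hide the loss of an entry. -/
theorem one_lt_card_frac (hz : z ∈ Feasible G) {i : Fin r} {j : Fin n} (hj : j ∈ frac (G i) z) :
    1 < (frac (G i) z).card := by
  classical
  rw [mem_frac] at hj
  obtain ⟨hji, h0, h1⟩ := hj
  have hz0 := fun k => (hz.1 k).1
  have hlt : z j < 1 := lt_of_le_of_ne (hz.1 j).2 h1
  have hpos : 0 < z j := lt_of_le_of_ne (hz0 j) (Ne.symm h0)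
  have hsum := Finset.add_sum_erase (G i) z hji
  rw [hz.2 i] at hsum
  obtain ⟨k, hk, hk0⟩ : ∃ k ∈ (G i).erase j, 0 < z k :=
    Finset.exists_lt_of_sum_lt (by simp only [Finset.sum_const_zero]; linarith)
  have hk1 : z k ≤ ∑ k ∈ (G i).erase j, z k :=
    Finset.single_le_sum (f := z) (fun k _ => hz0 k) hk
  rw [Finset.mem_erase] at hk
  exact Finset.one_lt_card.2 ⟨j, mem_frac.2 ⟨hji, h0, h1⟩, k,
    mem_frac.2 ⟨hk.2, hk0.ne', by linarith⟩, hk.1.symm⟩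

theorem IsDirection.totalT_add_lt (hG : IsPartition G) (hz : z ∈ Feasible G)
    (h : IsDirection G M z J δ) {j : Fin n} (hj : j ∈ frac Finset.univ z)
    (hjδ : z j + δ j = 0 ∨ z j + δ j = 1) : totalT G (z + δ) < totalT G z := by
  obtain ⟨i, hi, -⟩ := hG j
  refine Finset.sum_lt_sum (fun i _ => h.blockT_add_le i) ⟨i, Finset.mem_univ i, ?_⟩
  have hj' : j ∈ frac (G i) z := mem_frac.2 ⟨hi, (mem_frac.1 hj).2⟩
  have hcard := one_lt_card_frac hz hj'
  have hlt : (frac (G i) (z + δ)).card < (frac (G i) z).card := by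
    refine Finset.card_lt_card ((Finset.ssubset_iff_of_subset (h.frac_add_subset _)).2
      ⟨j, hj', fun hj2 => ?_⟩)
    have := (mem_frac.1 hj2).2
    exact hjδ.elim this.1 this.2
  unfold blockT
  omega

theorem IsDirection.totalT_lt_or (hG : IsPartition G) (hz : z ∈ Feasible G)
    (h : IsDirection G M z J δ) :
    totalT G (z + δ) < totalT G z ∨ totalT G (z - δ) < totalT G z := by
  obtain ⟨j, hj, hr | hr⟩ := h.rounds
  · exact Or.inl (h.totalT_add_lt hG hz hj hr)
  · right
    rw [sub_eq_add_neg]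
    exact h.neg.totalT_add_lt hG hz hj (by simpa [← sub_eq_add_neg] using hr)

theorem IsDirection.totalT_sub_le (h : IsDirection G M z J δ) : totalT G (z - δ) ≤ totalT G z := by
  rw [sub_eq_add_neg]
  exact h.neg.totalT_add_le

end Feasible

/-! ### The potential function -/

section Potential

variable {n r m : ℕ} {G : Fin r → Finset (Fin n)} {M : Matrix (Fin m) (Fin n) ℝ}
  {z w δ : Fin n → ℝ} {d : ℝ} {J : Finset (Fin r)}

/-- The weight of the block `i`. -/
def blockVal (G : Fin r → Finset (Fin n)) (w z : Fin n → ℝ) (i : Fin r) : ℝ :=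
  ∑ j ∈ G i, z j * w j

/-- The product over the blocks of the upper bounds `1 - d z(G i)·w` for the expectation of
`(1 - d) ^ (w of the selected item)`. -/
def potential (G : Fin r → Finset (Fin n)) (w : Fin n → ℝ) (d : ℝ) (z : Fin n → ℝ) : ℝ :=
  ∏ i, (1 - d * blockVal G w z i)

theorem blockVal_nonneg (hw : ∀ j, 0 ≤ w j ∧ w j ≤ 1) (hz : z ∈ Feasible G) (i : Fin r) :
    0 ≤ blockVal G w z i :=
  Finset.sum_nonneg fun j _ => mul_nonneg (hz.1 j).1 (hw j).1

theorem blockVal_le_one (hw : ∀ j, 0 ≤ w j ∧ w j ≤ 1) (hz : z ∈ Feasible G) (i : Fin r) :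
    blockVal G w z i ≤ 1 := by
  rw [← hz.2 i]
  exact Finset.sum_le_sum fun j _ => mul_le_of_le_one_right (hz.1 j).1 (hw j).2

theorem sum_blockVal (hG : IsPartition G) (w z : Fin n → ℝ) :
    ∑ i, blockVal G w z i = z ⬝ᵥ w :=
  hG.sum_sum fun j => z j * w j

theorem blockVal_add (w z δ : Fin n → ℝ) (i : Fin r) :
    blockVal G w (z + δ) i = blockVal G w z i + blockVal G w δ i := by
  simp [blockVal, add_mul, Finset.sum_add_distrib]

theorem blockVal_sub (w z δ : Fin n → ℝ) (i : Fin r) :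
    blockVal G w (z - δ) i = blockVal G w z i - blockVal G w δ i := by
  simp [blockVal, sub_mul, Finset.sum_sub_distrib]

theorem one_sub_mul_blockVal_nonneg (hw : ∀ j, 0 ≤ w j ∧ w j ≤ 1) (hd0 : 0 ≤ d) (hd1 : d ≤ 1)
    (hz : z ∈ Feasible G) (i : Fin r) : 0 ≤ 1 - d * blockVal G w z i := by
  nlinarith [blockVal_nonneg hw hz i, blockVal_le_one hw hz i]

theorem potential_nonneg (hw : ∀ j, 0 ≤ w j ∧ w j ≤ 1) (hd0 : 0 ≤ d) (hd1 : d ≤ 1)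
    (hz : z ∈ Feasible G) : 0 ≤ potential G w d z :=
  Finset.prod_nonneg fun i _ => one_sub_mul_blockVal_nonneg hw hd0 hd1 hz i

theorem potential_le_exp (hG : IsPartition G) (hw : ∀ j, 0 ≤ w j ∧ w j ≤ 1) (hd0 : 0 ≤ d)
    (hd1 : d ≤ 1) (hz : z ∈ Feasible G) :
    potential G w d z ≤ Real.exp (-(d * (z ⬝ᵥ w))) := by
  rw [← sum_blockVal hG, Finset.mul_sum, ← Finset.sum_neg_distrib]
  simp only [potential, sub_eq_add_neg]
  exact prod_one_add_le_exp_sum _ _ fun i _ => by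
    linarith [one_sub_mul_blockVal_nonneg hw hd0 hd1 hz i]

theorem IsDirection.blockVal_eq_zero (h : IsDirection G M z J δ) {i : Fin r} (hi : i ∉ J) :
    blockVal G w δ i = 0 :=
  Finset.sum_eq_zero fun j hj => by rw [h.off i hi j hj, zero_mul]

/-- Both signs keep the block value `v` in `[0,1]`, so the change is at most `min v (1 - v)`; then
`min x (1 - x) ≤ 2 x (1 - x)` with `x = d v`. The factor `1 - d v` thus has relative change at most
`2 d v`, which sums over blocks to a multiple of `z ⬝ᵥ w`. -/
theorem IsDirection.abs_blockVal_le (hw : ∀ j, 0 ≤ w j ∧ w j ≤ 1) (hd0 : 0 ≤ d) (hd1 : d ≤ 1)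
    (hz : z ∈ Feasible G) (h : IsDirection G M z J δ) (i : Fin r) :
    |d * blockVal G w δ i| ≤ 2 * (d * blockVal G w z i) * (1 - d * blockVal G w z i) := by
  have h1 := blockVal_nonneg hw (h.add_feasible hz) i
  have h2 := blockVal_nonneg hw (h.sub_feasible hz) i
  have h3 := blockVal_le_one hw (h.add_feasible hz) i
  have h4 := blockVal_le_one hw (h.sub_feasible hz) i
  have h5 := one_sub_mul_blockVal_nonneg hw hd0 hd1 hz i
  have h6 := mul_nonneg hd0 (blockVal_nonneg hw hz i)
  rw [blockVal_add] at h1 h3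
  rw [blockVal_sub] at h2 h4
  set v := blockVal G w z i
  set b := blockVal G w δ i
  rw [abs_mul, abs_of_nonneg hd0]
  have h7 : |b| ≤ v := abs_le.2 ⟨by linarith, by linarith⟩
  have h8 : |b| ≤ 1 - v := abs_le.2 ⟨by linarith, by linarith⟩
  have h9 : d * |b| ≤ d * v := mul_le_mul_of_nonneg_left h7 hd0
  have h10 : d * |b| ≤ 1 - d * v := by nlinarith [mul_le_mul_of_nonneg_left h8 hd0]
  rcases le_total (d * v) (1 / 2) with hh | hh <;> nlinarith

theorem prod_ite_mem_one_add (J : Finset (Fin r)) (ρ : Fin r → ℝ) (f : ℝ → ℝ) (hf : f 0 = 1) :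
    ∏ i, f (if i ∈ J then ρ i else 0) = ∏ i ∈ J, f (ρ i) := by
  rw [← Finset.prod_subset (Finset.subset_univ J)]
  · exact Finset.prod_congr rfl fun i hi => by rw [if_pos hi]
  · intro i _ hi
    rw [if_neg hi, hf]

theorem IsDirection.abs_blockVal_le_ite (hw : ∀ j, 0 ≤ w j ∧ w j ≤ 1) (hd0 : 0 ≤ d) (hd1 : d ≤ 1)
    (hz : z ∈ Feasible G) (h : IsDirection G M z J δ) (i : Fin r) :
    |-(d * blockVal G w δ i)| ≤
      (if i ∈ J then 2 * (d * blockVal G w z i) else 0) * (1 - d * blockVal G w z i) := by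
  rw [abs_neg]
  split_ifs with hi
  · exact h.abs_blockVal_le hw hd0 hd1 hz i
  · simp [h.blockVal_eq_zero hi]

theorem IsDirection.potential_add_potential_sub_le (hw : ∀ j, 0 ≤ w j ∧ w j ≤ 1) (hd0 : 0 ≤ d)
    (hd1 : d ≤ 1) (hz : z ∈ Feasible G) (h : IsDirection G M z J δ) :
    potential G w d (z + δ) + potential G w d (z - δ) ≤ potential G w d z *
      (∏ i ∈ J, (1 + 2 * (d * blockVal G w z i)) + ∏ i ∈ J, (1 - 2 * (d * blockVal G w z i))) := by
  have h1 := (abs_prod_add_prod_sub_le Finset.univ (fun i => 1 - d * blockVal G w z i)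
    (fun i => -(d * blockVal G w δ i)) (fun i => if i ∈ J then 2 * (d * blockVal G w z i) else 0)
    (fun i _ => one_sub_mul_blockVal_nonneg hw hd0 hd1 hz i)
    (fun i _ => h.abs_blockVal_le_ite hw hd0 hd1 hz i) (fun i _ => by
      have := mul_nonneg hd0 (blockVal_nonneg hw hz i)
      split_ifs <;> linarith)).1
  rw [prod_ite_mem_one_add J _ (fun x => 1 + x) (by simp),
    prod_ite_mem_one_add J _ (fun x => 1 - x) (by simp)] at h1
  refine le_trans (le_of_eq ?_) ((le_abs_self _).trans h1)
  simp only [potential, blockVal_add, blockVal_sub]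
  congr 1 <;> exact Finset.prod_congr rfl fun i _ => by ring

/-- The drop of the level weight is collected only at the sign that rounds an entry, so `Φ` must not
be negligible there. -/
theorem IsDirection.le_potential_add (hw : ∀ j, 0 ≤ w j ∧ w j ≤ 1) (hd0 : 0 ≤ d)
    (hd1 : d ≤ 1) (hz : z ∈ Feasible G) (h : IsDirection G M z J δ) :
    potential G w d z * ∏ i ∈ J, (1 - min 1 (2 * (d * blockVal G w z i))) ≤
      potential G w d (z + δ) := by
  have h2 : ∀ i, (1 - d * blockVal G w z i) + -(d * blockVal G w δ i) =
      1 - d * blockVal G w (z + δ) i := fun i => by rw [blockVal_add]; ring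
  have h1 := prod_mul_prod_one_sub_min_le Finset.univ (fun i => 1 - d * blockVal G w z i)
    (fun i => -(d * blockVal G w δ i)) (fun i => if i ∈ J then 2 * (d * blockVal G w z i) else 0)
    (fun i _ => one_sub_mul_blockVal_nonneg hw hd0 hd1 hz i)
    (fun i _ => by
      rw [h2]
      exact one_sub_mul_blockVal_nonneg hw hd0 hd1 (h.add_feasible hz) i)
    (fun i _ => h.abs_blockVal_le_ite hw hd0 hd1 hz i)
  rw [prod_ite_mem_one_add J _ (fun x => 1 - min 1 x) (by simp)] at h1
  simp only [h2] at h1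
  exact h1

theorem IsDirection.le_potential_sub (hw : ∀ j, 0 ≤ w j ∧ w j ≤ 1) (hd0 : 0 ≤ d)
    (hd1 : d ≤ 1) (hz : z ∈ Feasible G) (h : IsDirection G M z J δ) :
    potential G w d z * ∏ i ∈ J, (1 - min 1 (2 * (d * blockVal G w z i))) ≤
      potential G w d (z - δ) := by
  rw [sub_eq_add_neg]
  exact h.neg.le_potential_add hw hd0 hd1 hz

end Potential

/-! ### The level weights -/

/-- A weight that grows with the number `T` of fractional entries. -/
def levelWeight (K : ℝ) (t T : ℕ) : ℝ := ∏ s ∈ Finset.Ioc t T, (1 + K / (s : ℝ) ^ 2)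

section LevelWeight

variable {K : ℝ}

theorem levelWeight_of_le (K : ℝ) {t T : ℕ} (h : T ≤ t) : levelWeight K t T = 1 := by
  rw [levelWeight, Finset.Ioc_eq_empty (by omega), Finset.prod_empty]

theorem levelWeight_succ (K : ℝ) {t T : ℕ} (h : t ≤ T) :
    levelWeight K t (T + 1) = levelWeight K t T * (1 + K / ((T : ℝ) + 1) ^ 2) := by
  unfold levelWeight
  rw [Finset.prod_Ioc_succ_top h]
  simp

theorem levelWeight_nonneg (hK : 0 ≤ K) (t T : ℕ) : 0 ≤ levelWeight K t T :=
  Finset.prod_nonneg fun s _ => by positivity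

theorem levelWeight_mono (hK : 0 ≤ K) (t : ℕ) : Monotone (levelWeight K t) := by
  refine monotone_nat_of_le_succ fun T => ?_
  rcases le_or_gt t T with h | h
  · rw [levelWeight_succ K h]
    refine le_mul_of_one_le_right (levelWeight_nonneg hK t T) ?_
    have : 0 ≤ K / ((T : ℝ) + 1) ^ 2 := by positivity
    linarith
  · rw [levelWeight_of_le K h.le, levelWeight_of_le K h]

theorem one_le_levelWeight (hK : 0 ≤ K) (t T : ℕ) : 1 ≤ levelWeight K t T := by
  rw [← levelWeight_of_le K (Nat.zero_le t)]
  exact levelWeight_mono hK t (Nat.zero_le T)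

/-- Telescoping: `1/(T+1)² ≤ 1/T - 1/(T+1)`, so the exponents above level `t` sum to at most `K/t`.
-/
theorem levelWeight_le (hK : 0 ≤ K) {t : ℕ} (ht : 0 < t) (T : ℕ) :
    levelWeight K t T ≤ Real.exp (K / t) := by
  have key : ∀ T, t ≤ T → levelWeight K t T ≤ Real.exp (K * (1 / t - 1 / T)) := by
    intro T hT
    induction T, hT using Nat.le_induction with
    | base => simp [levelWeight]
    | succ T hT ih =>
      have hT0 : (0 : ℝ) < T := by exact_mod_cast ht.trans_le hT
      rw [levelWeight_succ K hT]
      calc levelWeight K t T * (1 + K / ((T : ℝ) + 1) ^ 2)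
          ≤ Real.exp (K * (1 / t - 1 / T)) * Real.exp (K / ((T : ℝ) + 1) ^ 2) := by
            gcongr
            linarith [Real.add_one_le_exp (K / ((T : ℝ) + 1) ^ 2)]
        _ = Real.exp (K * (1 / t - 1 / T) + K * (1 / ((T : ℝ) + 1) ^ 2)) := by
            rw [← Real.exp_add]
            congr 1
            ring
        _ ≤ _ := by
            rw [← mul_add]
            gcongr
            push_cast
            have h1 : 1 / ((T : ℝ) + 1) ^ 2 ≤ 1 / (T * ((T : ℝ) + 1)) := by
              gcongr
              nlinarith
            have h2 : 1 / (T * ((T : ℝ) + 1)) = 1 / T - 1 / ((T : ℝ) + 1) := by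
              field_simp
              ring
            linarith
  rcases le_total t T with h | h
  · refine (key T h).trans (Real.exp_le_exp.2 ?_)
    rw [mul_sub, mul_one_div]
    have : 0 ≤ K * (1 / (T : ℝ)) := by positivity
    linarith
  · rw [levelWeight_of_le K h]
    exact Real.one_le_exp (by positivity)

end LevelWeight

/-! ### One iteration of the main loop -/

section Sampling

variable {r m : ℕ} {p : ℝ} {ρ : Fin r → ℝ} {T : Fin r → ℕ}

/-- The bounds on `p` and `ρ` give `p * ρ i ≤ 1`, so the factors `1 ± p * ρ i` are nonnegative and
their products are at most `e^{±u}`, with `u` the sum of the `p * ρ i`. -/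
theorem sum_subsetWeight_even_le (h0 : 0 ≤ p) (h1 : p ≤ 1 / 4) (hρ0 : ∀ i, 0 ≤ ρ i)
    (hρ2 : ∀ i, ρ i ≤ 2) :
    ∑ J : Finset (Fin r), subsetWeight p J * (∏ i ∈ J, (1 + ρ i) + ∏ i ∈ J, (1 - ρ i)) ≤
      2 + (p * ∑ i, ρ i) ^ 2 * Real.exp (p * ∑ i, ρ i) := by
  have hx0 : ∀ i, 0 ≤ p * ρ i := fun i => mul_nonneg h0 (hρ0 i)
  have hx1 : ∀ i, p * ρ i ≤ 1 := fun i => by nlinarith [hρ0 i, hρ2 i]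
  simp only [mul_add, Finset.sum_add_distrib, sum_subsetWeight_mul_prod]
  refine le_trans ?_ (exp_add_exp_neg_le _ (mul_nonneg h0 (Finset.sum_nonneg fun i _ => hρ0 i)))
  rw [Finset.mul_sum, ← Finset.sum_neg_distrib]
  refine add_le_add (le_trans (le_of_eq ?_) (prod_one_add_le_exp_sum _ _ fun i _ => ?_))
    (le_trans (le_of_eq ?_) (prod_one_add_le_exp_sum _ _ fun i _ => ?_))
  · exact Finset.prod_congr rfl fun i _ => by ring
  · linarith [hx0 i]
  · exact Finset.prod_congr rfl fun i _ => by ring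
  · linarith [hx1 i]

theorem le_sum_subsetWeight_large (h0 : 0 ≤ p) (h1 : p ≤ 1) (hm : 0 < m)
    (hT : ∀ i, T i ≤ m) (hp : p * (∑ i, T i : ℕ) = 3 * m) :
    1 / 4 ≤ ∑ J : Finset (Fin r), subsetWeight p J * (if m + 1 ≤ ∑ i ∈ J, T i then 1 else 0) := by
  have h2 := sum_subsetWeight_small_le h0 h1 hm T hT hp
  have h3 : ∑ J : Finset (Fin r), subsetWeight p J * (if m + 1 ≤ ∑ i ∈ J, T i then 0 else 1) +
      ∑ J : Finset (Fin r), subsetWeight p J * (if m + 1 ≤ ∑ i ∈ J, T i then 1 else 0) = 1 := by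
    refine Eq.trans ?_ (sum_subsetWeight (r := r) p)
    rw [← Finset.sum_add_distrib]
    exact Finset.sum_congr rfl fun J _ => by split_ifs <;> ring
  linarith

/-- Over all `J` the product averages at least `1 - p * ∑ i, ρ i`; discarding the small `J`, of
probability at most `3/4` and with product at most `1`, leaves `1/4 - p * ∑ i, ρ i`. -/
theorem le_sum_subsetWeight_large_mul_prod (h0 : 0 ≤ p) (h1 : p ≤ 1) (hm : 0 < m)
    (hT : ∀ i, T i ≤ m) (hp : p * (∑ i, T i : ℕ) = 3 * m) (hρ0 : ∀ i, 0 ≤ ρ i) :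
    max 0 (1 / 4 - p * ∑ i, ρ i) ≤ ∑ J : Finset (Fin r), subsetWeight p J *
      ((∏ i ∈ J, (1 - min 1 (ρ i))) * if m + 1 ≤ ∑ i ∈ J, T i then 1 else 0) := by
  have hmin0 : ∀ i, 0 ≤ min 1 (ρ i) := fun i => le_min zero_le_one (hρ0 i)
  have hmin1 : ∀ i, min 1 (ρ i) ≤ 1 := fun i => min_le_left _ _
  have hQ0 : ∀ J : Finset (Fin r), 0 ≤ ∏ i ∈ J, (1 - min 1 (ρ i)) := fun J =>
    Finset.prod_nonneg fun i _ => by linarith [hmin1 i]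
  have hQ1 : ∀ J : Finset (Fin r), ∏ i ∈ J, (1 - min 1 (ρ i)) ≤ 1 := fun J =>
    Finset.prod_le_one (fun i _ => by linarith [hmin1 i]) fun i _ => by linarith [hmin0 i]
  have hwt := fun J : Finset (Fin r) => subsetWeight_nonneg h0 h1 J
  refine max_le (Finset.sum_nonneg fun J _ => mul_nonneg (hwt J) (mul_nonneg (hQ0 J) ?_)) ?_
  · split_ifs <;> norm_num
  have hsmall := sum_subsetWeight_small_le h0 h1 hm T hT hp
  have hall : 1 - p * ∑ i, ρ i ≤
      ∑ J : Finset (Fin r), subsetWeight p J * ∏ i ∈ J, (1 - min 1 (ρ i)) := by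
    rw [sum_subsetWeight_mul_prod]
    calc 1 - p * ∑ i, ρ i ≤ 1 - ∑ i, p * min 1 (ρ i) := by
          rw [← Finset.mul_sum]
          gcongr
          exact min_le_right _ _
      _ ≤ ∏ i, (1 - p * min 1 (ρ i)) :=
          one_sub_sum_le_prod_one_sub _ _ (fun i _ => mul_nonneg h0 (hmin0 i))
            fun i _ => mul_le_one₀ h1 (hmin0 i) (hmin1 i)
      _ = _ := Finset.prod_congr rfl fun i _ => by ring
  have hsplit : ∑ J : Finset (Fin r), subsetWeight p J * ∏ i ∈ J, (1 - min 1 (ρ i)) ≤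
      ∑ J : Finset (Fin r), subsetWeight p J *
        ((∏ i ∈ J, (1 - min 1 (ρ i))) * if m + 1 ≤ ∑ i ∈ J, T i then 1 else 0) +
      ∑ J : Finset (Fin r), subsetWeight p J * (if m + 1 ≤ ∑ i ∈ J, T i then 0 else 1) := by
    rw [← Finset.sum_add_distrib]
    refine Finset.sum_le_sum fun J _ => ?_
    rw [← mul_add]
    refine mul_le_mul_of_nonneg_left ?_ (hwt J)
    split_ifs
    · simp
    · simpa using hQ1 J
  linarith

end Sampling

/-! ### Drift of `T` and of the weighted potential in one iteration -/

section Iteration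

variable {n r m : ℕ} {G : Fin r → Finset (Fin n)} {M : Matrix (Fin m) (Fin n) ℝ}
  {z w : Fin n → ℝ}

/-- The vectors that occur in the main loop. -/
def Reduced (G : Fin r → Finset (Fin n)) (m : ℕ) : Set (Fin n → ℝ) :=
  {z | z ∈ Feasible G ∧ ∀ i, blockT G z i ≤ m}

theorem IsDirection.add_reduced {J : Finset (Fin r)} {δ : Fin n → ℝ} (h : IsDirection G M z J δ)
    (hz : z ∈ Reduced G m) : z + δ ∈ Reduced G m :=
  ⟨h.add_feasible hz.1, fun i => (h.blockT_add_le i).trans (hz.2 i)⟩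

theorem IsDirection.sub_reduced {J : Finset (Fin r)} {δ : Fin n → ℝ} (h : IsDirection G M z J δ)
    (hz : z ∈ Reduced G m) : z - δ ∈ Reduced G m := by
  rw [sub_eq_add_neg]
  exact h.neg.add_reduced hz

theorem mem_reduced_of_mem_support_iteration {d : Finset (Fin r) → PMF (Fin n → ℝ)}
    (hz : z ∈ Reduced G m)
    (hd : ∀ J : Finset (Fin r), m + 1 ≤ ∑ i ∈ J, blockT G z i →
      ∀ δ ∈ (d J).support, IsDirection G M z J δ) :
    ∀ z' ∈ (iteration G m d z).support, z' ∈ Reduced G m := by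
  intro z' hz'
  rw [iteration, PMF.mem_support_bind_iff] at hz'
  obtain ⟨J, -, hJ⟩ := hz'
  split_ifs at hJ with h
  · rw [PMF.mem_support_bind_iff] at hJ
    obtain ⟨δ, hδ, h2⟩ := hJ
    rw [PMF.mem_support_bind_iff] at h2
    obtain ⟨b, -, hb⟩ := h2
    rw [PMF.mem_support_pure_iff] at hb
    rw [hb]
    split_ifs
    · exact (hd J h δ hδ).add_reduced hz
    · exact (hd J h δ hδ).sub_reduced hz
  · rw [PMF.mem_support_pure_iff] at hJ
    rwa [hJ]

/-- Only the average over the two signs matters, so a bound uniform in the direction removes the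
random choice of `δ` and leaves a finite sum over `J`. -/
theorem expect_iteration_le {d : Finset (Fin r) → PMF (Fin n → ℝ)} (hz : z ∈ Feasible G)
    (hd : ∀ J : Finset (Fin r), m + 1 ≤ ∑ i ∈ J, blockT G z i →
      ∀ δ ∈ (d J).support, IsDirection G M z J δ)
    (F : (Fin n → ℝ) → ℝ) (hF : ∀ x ∈ Feasible G, 0 ≤ F x) (B : Finset (Fin r) → ℝ)
    (hB : ∀ J : Finset (Fin r), m + 1 ≤ ∑ i ∈ J, blockT G z i →
      ∀ δ, IsDirection G M z J δ → F (z + δ) + F (z - δ) ≤ 2 * B J)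
    (hB' : ∀ J : Finset (Fin r), ¬ m + 1 ≤ ∑ i ∈ J, blockT G z i → F z ≤ B J)
    (hB0 : ∀ J, 0 ≤ B J) :
    expect (iteration G m d z) (fun x => ENNReal.ofReal (F x)) ≤
      ENNReal.ofReal (∑ J, subsetWeight (sampleProb m (totalT G z)) J * B J) := by
  have hp1 : sampleProb m (totalT G z) ≤ 1 := min_le_right _ _
  have hwt := fun J : Finset (Fin r) => subsetWeight_nonneg
    (NNReal.coe_nonneg (sampleProb m (totalT G z))) (by exact_mod_cast hp1) J
  rw [iteration, expect_bind, expect_fintype,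
    ENNReal.ofReal_sum_of_nonneg fun J _ => mul_nonneg (hwt J) (hB0 J)]
  refine Finset.sum_le_sum fun J _ => ?_
  refine (mul_le_mul' (randomSubset_apply _ hp1 J).le ?_).trans_eq (ENNReal.ofReal_mul (hwt J)).symm
  split_ifs with h
  · rw [expect_bind]
    refine expect_le_const fun δ hδ => ?_
    have hδ' := hd J h δ hδ
    have h1 := hF _ (hδ'.add_feasible hz)
    have h2 := hF _ (hδ'.sub_feasible hz)
    rw [expect_bind, expect_fintype]
    simp only [expect_pure, PMF.uniformOfFintype_apply, Fintype.card_bool, Fintype.sum_bool,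
      if_true, Bool.false_eq_true, if_false]
    have h3 : ((2 : ℕ) : ℝ≥0∞)⁻¹ = ENNReal.ofReal (1 / 2) := by
      rw [one_div, ENNReal.ofReal_inv_of_pos two_pos]
      norm_num
    rw [h3, ← mul_add, ← ENNReal.ofReal_add h1 h2, ← ENNReal.ofReal_mul (by norm_num)]
    exact ENNReal.ofReal_le_ofReal (by linarith [hB J h δ hδ'])
  · rw [expect_pure]
    exact ENNReal.ofReal_le_ofReal (hB' J h)

theorem coe_sampleProb {T : ℕ} (h : 12 * m < T) : (sampleProb m T : ℝ) = 3 * m / T := by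
  have hT : (0 : ℝ) < T := by exact_mod_cast (Nat.zero_le _).trans_lt h
  have h' : (12 : ℝ) * m < T := by exact_mod_cast h
  rw [sampleProb, NNReal.coe_min]
  push_cast
  refine min_eq_left ?_
  rw [div_le_one hT]
  linarith [(Nat.cast_nonneg m : (0 : ℝ) ≤ m)]

theorem coe_sampleProb_le {T : ℕ} (h : 12 * m < T) : (sampleProb m T : ℝ) ≤ 1 / 4 := by
  have hT : (0 : ℝ) < T := by exact_mod_cast (Nat.zero_le _).trans_lt h
  have h' : (12 : ℝ) * m < T := by exact_mod_cast h
  rw [coe_sampleProb h, div_le_div_iff₀ hT (by norm_num)]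
  linarith

theorem coe_sampleProb_mul {T : ℕ} (h : 12 * m < T) : (sampleProb m T : ℝ) * T = 3 * m := by
  have hT : (T : ℝ) ≠ 0 := by exact_mod_cast ((Nat.zero_le _).trans_lt h).ne'
  rw [coe_sampleProb h, div_mul_cancel₀ _ hT]

theorem pos_of_lt_totalT (hz : z ∈ Reduced G m) (h : 12 * m < totalT G z) : 0 < m := by
  rcases Nat.eq_zero_or_pos m with rfl | hm
  · have : totalT G z = 0 := Finset.sum_eq_zero fun i _ => Nat.le_zero.1 (hz.2 i)
    omega
  · exact hm

/-- Each iteration decreases the number of fractional entries with constant probability. -/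
theorem expect_totalT_iteration_le (hG : IsPartition G) {t : ℕ} (ht : 12 * m < t)
    (htz : t < totalT G z) {d : Finset (Fin r) → PMF (Fin n → ℝ)} (hz : z ∈ Reduced G m)
    (hd : ∀ J : Finset (Fin r), m + 1 ≤ ∑ i ∈ J, blockT G z i →
      ∀ δ ∈ (d J).support, IsDirection G M z J δ) :
    expect (iteration G m d z) (fun x => ENNReal.ofReal (totalT G x)) ≤
      ENNReal.ofReal (totalT G z - 1 / 8) := by
  have hT1 : (1 : ℝ) ≤ totalT G z := by exact_mod_cast (Nat.zero_le _).trans_lt htz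
  refine (expect_iteration_le hz.1 hd _ (fun x _ => Nat.cast_nonneg _)
    -- At least one of two equally likely signs lowers `T`: half a unit on average, with probability
    -- at least `1/4` of a large `J`.
    (fun J => totalT G z - 1 / 2 * (if m + 1 ≤ ∑ i ∈ J, blockT G z i then 1 else 0))
    ?_ ?_ ?_).trans (ENNReal.ofReal_le_ofReal ?_)
  · intro J hJ δ hδ
    rw [if_pos hJ]
    have h1 := hδ.totalT_add_le
    have h2 := hδ.totalT_sub_le
    have h3 := hδ.totalT_lt_or hG hz.1
    have h4 : totalT G (z + δ) + totalT G (z - δ) + 1 ≤ 2 * totalT G z := by omega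
    have h5 : (totalT G (z + δ) + totalT G (z - δ) + 1 : ℝ) ≤ 2 * totalT G z := by
      exact_mod_cast h4
    linarith
  · intro J hJ
    rw [if_neg hJ]
    linarith
  · intro J
    split_ifs <;> linarith
  · have h12 := ht.trans htz
    have := le_sum_subsetWeight_large (NNReal.coe_nonneg (sampleProb m (totalT G z)))
      ((coe_sampleProb_le h12).trans (by norm_num)) (pos_of_lt_totalT hz h12) hz.2
      (coe_sampleProb_mul h12)
    simp only [mul_sub, Finset.sum_sub_distrib, mul_left_comm _ (1 / 2 : ℝ)]
    rw [← Finset.mul_sum, ← Finset.sum_mul, sum_subsetWeight]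
    linarith

/-- The potential function, weighted by the number of fractional entries. -/
def weightedPotential (G : Fin r → Finset (Fin n)) (w : Fin n → ℝ) (d ε K : ℝ) (t : ℕ)
    (z : Fin n → ℝ) : ℝ :=
  (potential G w d z + ε) * levelWeight K t (totalT G z)

/-- Charge both signs with the current level weight, then refund one level's difference at the sign
that rounds, using the lower bound for `Φ` there. -/
theorem weightedPotential_add_sub_le (hG : IsPartition G) (hw : ∀ j, 0 ≤ w j ∧ w j ≤ 1)
    {d ε K : ℝ} (hd0 : 0 ≤ d) (hd1 : d ≤ 1) (hε : 0 ≤ ε) (hK : 0 ≤ K) (t : ℕ)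
    (hz : z ∈ Feasible G) {J : Finset (Fin r)} {δ : Fin n → ℝ} (h : IsDirection G M z J δ) :
    weightedPotential G w d ε K t (z + δ) + weightedPotential G w d ε K t (z - δ) ≤
      (potential G w d z * (∏ i ∈ J, (1 + 2 * (d * blockVal G w z i)) +
          ∏ i ∈ J, (1 - 2 * (d * blockVal G w z i))) + 2 * ε) * levelWeight K t (totalT G z) -
      (levelWeight K t (totalT G z) - levelWeight K t (totalT G z - 1)) *
        (potential G w d z * ∏ i ∈ J, (1 - min 1 (2 * (d * blockVal G w z i))) + ε) := by
  have h1 := h.potential_add_potential_sub_le hw hd0 hd1 hz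
  have h2 := h.le_potential_add hw hd0 hd1 hz
  have h3 := h.le_potential_sub hw hd0 hd1 hz
  have hΔ := sub_nonneg.2 (levelWeight_mono hK t (Nat.sub_le (totalT G z) 1))
  have hadd := levelWeight_mono hK t h.totalT_add_le
  have hsub := levelWeight_mono hK t h.totalT_sub_le
  have hg := levelWeight_nonneg hK t (totalT G z)
  have hp := potential_nonneg hw hd0 hd1 (h.add_feasible hz)
  have hq := potential_nonneg hw hd0 hd1 (h.sub_feasible hz)
  have h4 := mul_le_mul_of_nonneg_right h1 hg
  unfold weightedPotential
  rcases h.totalT_lt_or hG hz with hlt | hlt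
  · have h5 := levelWeight_mono hK t (Nat.le_sub_one_of_lt hlt)
    have h6 := mul_le_mul_of_nonneg_left h5 (add_nonneg hp hε)
    have h7 := mul_le_mul_of_nonneg_left hsub (add_nonneg hq hε)
    have h8 := mul_le_mul_of_nonneg_left h2 hΔ
    linarith
  · have h5 := levelWeight_mono hK t (Nat.le_sub_one_of_lt hlt)
    have h6 := mul_le_mul_of_nonneg_left h5 (add_nonneg hq hε)
    have h7 := mul_le_mul_of_nonneg_left hadd (add_nonneg hp hε)
    have h8 := mul_le_mul_of_nonneg_left h3 hΔ
    linarith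

/-- The even-part inequality with zero perturbation. It ensures that the bound used for large `J`
also covers the small `J`, where the vector stays put. -/
theorem two_le_prod_add_prod (J : Finset (Fin r)) {ρ : Fin r → ℝ} (hρ : ∀ i, 0 ≤ ρ i) :
    2 ≤ ∏ i ∈ J, (1 + ρ i) + ∏ i ∈ J, (1 - ρ i) := by
  have h := (abs_prod_add_prod_sub_le J (fun _ => 1) (fun _ => 0) ρ (fun _ _ => zero_le_one)
    (fun i _ => by simpa using hρ i) (fun i _ => hρ i)).1
  norm_num at h
  exact h

/-- `hbound` is the balance of drifts: growth of `Φ` on the left, refund from the level weight on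
the right, each doubled. -/
theorem expect_weightedPotential_iteration_le (hG : IsPartition G)
    (hw : ∀ j, 0 ≤ w j ∧ w j ≤ 1)
    {d ε K : ℝ} (hd0 : 0 ≤ d) (hd1 : d ≤ 1) (hε : 0 ≤ ε) (hK : 0 ≤ K) {t : ℕ} (ht : 12 * m < t)
    (htz : t < totalT G z) {D : Finset (Fin r) → PMF (Fin n → ℝ)} (hz : z ∈ Reduced G m)
    (hD : ∀ J : Finset (Fin r), m + 1 ≤ ∑ i ∈ J, blockT G z i →
      ∀ δ ∈ (D J).support, IsDirection G M z J δ)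
    {u : ℝ} (hu : u = 6 * m / totalT G z * (d * (z ⬝ᵥ w)))
    (hbound : potential G w d z * (u ^ 2 * Real.exp u) * levelWeight K t (totalT G z) ≤
      (levelWeight K t (totalT G z) - levelWeight K t (totalT G z - 1)) *
        (potential G w d z * max 0 (1 / 4 - u) + ε / 4)) :
    expect (iteration G m D z) (fun x => ENNReal.ofReal (weightedPotential G w d ε K t x)) ≤
      ENNReal.ofReal (weightedPotential G w d ε K t z) := by
  have hΔ := sub_nonneg.2 (levelWeight_mono hK t (Nat.sub_le (totalT G z) 1))
  have hΔg : levelWeight K t (totalT G z) - levelWeight K t (totalT G z - 1) ≤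
      levelWeight K t (totalT G z) := by linarith [levelWeight_nonneg hK t (totalT G z - 1)]
  have hg := levelWeight_nonneg hK t (totalT G z)
  have hΦ := potential_nonneg hw hd0 hd1 hz.1
  set g := levelWeight K t (totalT G z)
  set Δ := g - levelWeight K t (totalT G z - 1)
  set Φ := potential G w d z
  have hρ0 : ∀ i, 0 ≤ 2 * (d * blockVal G w z i) := fun i => by
    have := mul_nonneg hd0 (blockVal_nonneg hw hz.1 i)
    linarith
  have hρ2 : ∀ i, 2 * (d * blockVal G w z i) ≤ 2 := fun i => by
    linarith [one_sub_mul_blockVal_nonneg hw hd0 hd1 hz.1 i]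
  have h12 := ht.trans htz
  have hm := pos_of_lt_totalT hz h12
  have hp0 := NNReal.coe_nonneg (sampleProb m (totalT G z))
  have hp4 := coe_sampleProb_le h12
  have hp1 : (sampleProb m (totalT G z) : ℝ) ≤ 1 := hp4.trans (by norm_num)
  have hpT := coe_sampleProb_mul h12
  have hpu : (sampleProb m (totalT G z) : ℝ) * ∑ i, 2 * (d * blockVal G w z i) = u := by
    rw [coe_sampleProb h12, hu, ← Finset.mul_sum, ← Finset.mul_sum, sum_blockVal hG]
    ring
  have hQ0 : ∀ J : Finset (Fin r), 0 ≤ ∏ i ∈ J, (1 - min 1 (2 * (d * blockVal G w z i))) :=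
    fun J => Finset.prod_nonneg fun i _ => by linarith [min_le_left 1 (2 * (d * blockVal G w z i))]
  have hQ1 : ∀ J : Finset (Fin r), ∏ i ∈ J, (1 - min 1 (2 * (d * blockVal G w z i))) ≤ 1 :=
    fun J => Finset.prod_le_one
      (fun i _ => by linarith [min_le_left 1 (2 * (d * blockVal G w z i))])
      fun i _ => by linarith [le_min zero_le_one (hρ0 i)]
  have heven := sum_subsetWeight_even_le hp0 hp4 hρ0 hρ2
  have hlarge := le_sum_subsetWeight_large hp0 hp1 hm hz.2 hpT
  have hlargeQ := le_sum_subsetWeight_large_mul_prod hp0 hp1 hm hz.2 hpT hρ0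
  rw [hpu] at heven hlargeQ
  refine (expect_iteration_le hz.1 hD _ (fun x hx => mul_nonneg
      (add_nonneg (potential_nonneg hw hd0 hd1 hx) hε) (levelWeight_nonneg hK t _))
    (fun J => (Φ * (∏ i ∈ J, (1 + 2 * (d * blockVal G w z i)) +
          ∏ i ∈ J, (1 - 2 * (d * blockVal G w z i))) / 2 + ε) * g -
      Δ / 2 * (Φ * (∏ i ∈ J, (1 - min 1 (2 * (d * blockVal G w z i)))) + ε) *
        (if m + 1 ≤ ∑ i ∈ J, blockT G z i then 1 else 0))
    ?_ ?_ ?_).trans (ENNReal.ofReal_le_ofReal ?_)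
  · intro J hJ δ hδ
    refine (weightedPotential_add_sub_le hG hw hd0 hd1 hε hK t hz.1 hδ).trans (le_of_eq ?_)
    rw [if_pos hJ]
    simp only [Δ, g, Φ]
    ring
  · intro J hJ
    rw [if_neg hJ]
    have h2 := mul_le_mul_of_nonneg_left (two_le_prod_add_prod J hρ0) (mul_nonneg hΦ hg)
    change (Φ + ε) * g ≤ _
    linarith
  · intro J
    have h2 := mul_le_mul_of_nonneg_left (two_le_prod_add_prod J hρ0) (mul_nonneg hΦ hg)
    have h3 : Δ / 2 * (Φ * (∏ i ∈ J, (1 - min 1 (2 * (d * blockVal G w z i)))) + ε) ≤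
        g * (Φ * 1 + ε) :=
      mul_le_mul (by linarith) (by linarith [mul_le_mul_of_nonneg_left (hQ1 J) hΦ])
        (add_nonneg (mul_nonneg hΦ (hQ0 J)) hε) hg
    have h4 : 0 ≤ Δ / 2 * (Φ * (∏ i ∈ J, (1 - min 1 (2 * (d * blockVal G w z i)))) + ε) :=
      mul_nonneg (by linarith) (add_nonneg (mul_nonneg hΦ (hQ0 J)) hε)
    split_ifs <;> linarith
  · have hsum : ∑ J, subsetWeight (sampleProb m (totalT G z) : ℝ) J *
        ((Φ * (∏ i ∈ J, (1 + 2 * (d * blockVal G w z i)) +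
          ∏ i ∈ J, (1 - 2 * (d * blockVal G w z i))) / 2 + ε) * g -
        Δ / 2 * (Φ * (∏ i ∈ J, (1 - min 1 (2 * (d * blockVal G w z i)))) + ε) *
          (if m + 1 ≤ ∑ i ∈ J, blockT G z i then 1 else 0)) =
        Φ * g / 2 * ∑ J, subsetWeight (sampleProb m (totalT G z) : ℝ) J *
          (∏ i ∈ J, (1 + 2 * (d * blockVal G w z i)) +
            ∏ i ∈ J, (1 - 2 * (d * blockVal G w z i))) + ε * g *
        ∑ J : Finset (Fin r), subsetWeight (sampleProb m (totalT G z) : ℝ) J -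
        Δ / 2 * Φ * ∑ J : Finset (Fin r), subsetWeight (sampleProb m (totalT G z) : ℝ) J *
          ((∏ i ∈ J, (1 - min 1 (2 * (d * blockVal G w z i)))) *
            if m + 1 ≤ ∑ i ∈ J, blockT G z i then 1 else 0) -
        Δ / 2 * ε * ∑ J : Finset (Fin r), subsetWeight (sampleProb m (totalT G z) : ℝ) J *
          (if m + 1 ≤ ∑ i ∈ J, blockT G z i then 1 else 0) := by
      simp only [Finset.mul_sum]
      rw [← Finset.sum_add_distrib, ← Finset.sum_sub_distrib, ← Finset.sum_sub_distrib]
      exact Finset.sum_congr rfl fun J _ => by ring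
    rw [hsum, sum_subsetWeight]
    change _ ≤ (Φ + ε) * g
    have h1 := mul_le_mul_of_nonneg_left heven (mul_nonneg hΦ hg)
    have h2 := mul_le_mul_of_nonneg_left hlargeQ (mul_nonneg hΔ hΦ)
    have h3 := mul_le_mul_of_nonneg_left hlarge (mul_nonneg hΔ hε)
    linarith

/-- The parameters for which the weighted potential is a supermartingale. -/
theorem potential_increment_le (hG : IsPartition G) (hw : ∀ j, 0 ≤ w j ∧ w j ≤ 1)
    {d L : ℝ} (hd0 : 0 ≤ d) (hd1 : d ≤ 1) (hL : 4 ≤ L) {t : ℕ}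
    (ht : 12 * m < t) (htL : 48 * m * L ≤ t) (htz : t < totalT G z) (hz : z ∈ Feasible G)
    {u K : ℝ} (hK : K = 1152 * m ^ 2 * L ^ 2) (hu : u = 6 * m / totalT G z * (d * (z ⬝ᵥ w))) :
    potential G w d z * (u ^ 2 * Real.exp u) * levelWeight K t (totalT G z) ≤
      (levelWeight K t (totalT G z) - levelWeight K t (totalT G z - 1)) *
        (potential G w d z * max 0 (1 / 4 - u) + Real.exp (-(L / 4)) / 4) := by
  obtain ⟨T, hT⟩ : ∃ T, totalT G z = T + 1 := ⟨totalT G z - 1, by omega⟩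
  have hm0 : (0 : ℝ) ≤ m := Nat.cast_nonneg m
  have hK0 : 0 ≤ K := by rw [hK]; positivity
  have hΦ := potential_nonneg hw hd0 hd1 hz
  have hΦe := potential_le_exp hG hw hd0 hd1 hz
  have hX : 0 ≤ d * (z ⬝ᵥ w) :=
    mul_nonneg hd0 (Finset.sum_nonneg fun j _ => mul_nonneg (hz.1 j).1 (hw j).1)
  have hx : (0 : ℝ) < T + 1 := by positivity
  have htx : (t : ℝ) ≤ T + 1 := by rw [hT] at htz; exact_mod_cast htz.le
  have ht12 : (12 : ℝ) * m ≤ T + 1 := by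
    have : (12 * m : ℝ) < t := by exact_mod_cast ht
    linarith
  rw [hT] at hu ⊢
  rw [Nat.add_sub_cancel, levelWeight_succ K (by omega)]
  push_cast at hu
  have hgT := levelWeight_nonneg hK0 t T
  set g := levelWeight K t T
  set Φ := potential G w d z
  set X := d * (z ⬝ᵥ w)
  set x : ℝ := T + 1
  have hκ1 : K / x ^ 2 ≤ 1 := by
    rw [div_le_one (by positivity), hK]
    have : (48 * m * L) ^ 2 ≤ x ^ 2 := by
      gcongr
      linarith
    nlinarith [sq_nonneg (m * L)]
  have hu0 : 0 ≤ u := by rw [hu]; positivity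
  -- The weight at level `T + 1` is `1 + K / x ^ 2 ≤ 2` times the weight `g` at level `T`, and the
  -- difference is `g * (K / x ^ 2)`; so `g` cancels at the cost of a factor `2`.
  suffices h : 2 * (Φ * (u ^ 2 * Real.exp u)) ≤
      K / x ^ 2 * (Φ * max 0 (1 / 4 - u) + Real.exp (-(L / 4)) / 4) by
    have h1 := mul_le_mul_of_nonneg_left h hgT
    have h2 : 0 ≤ Φ * (u ^ 2 * Real.exp u) := by positivity
    have h3 := mul_le_mul_of_nonneg_left hκ1 (mul_nonneg h2 hgT)
    linarith
  rcases le_or_gt X L with hXL | hXL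
  -- Here `u ≤ 1/8`, so the refund on `Φ` alone suffices; `1152 = 8 * (2 * 36 * 2)` is chosen for
  -- this case.
  · have hu1 : u ≤ 6 * m / x * L := by
      rw [hu]
      gcongr
    have hu8 : u ≤ 1 / 8 := by
      refine hu1.trans ?_
      rw [div_mul_eq_mul_div, div_le_div_iff₀ hx (by norm_num)]
      linarith
    have hexp : Real.exp u ≤ 2 := by
      have h1 := exp_neg_le_one_sub_half hu0 (by linarith)
      have h2 : Real.exp u * Real.exp (-u) = 1 := by rw [← Real.exp_add]; simp
      have h3 := Real.add_one_le_exp (-u)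
      have h4 : Real.exp u * (7 / 8) ≤ Real.exp u * Real.exp (-u) := by
        gcongr
        linarith
      linarith
    have hmax : 1 / 8 ≤ max 0 (1 / 4 - u) := le_max_of_le_right (by linarith)
    calc 2 * (Φ * (u ^ 2 * Real.exp u)) ≤ 2 * (Φ * ((6 * m / x * L) ^ 2 * 2)) := by gcongr
      _ = K / x ^ 2 * (Φ * (1 / 8)) := by
          rw [hK]
          field_simp
          ring
      _ ≤ K / x ^ 2 * (Φ * max 0 (1 / 4 - u) + Real.exp (-(L / 4)) / 4) := by
          gcongr
          have := mul_le_mul_of_nonneg_left hmax hΦ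
          have := Real.exp_pos (-(L / 4))
          linarith
  -- Here `Φ * e^u ≤ e^{-X/2}`: one factor `e^{-X/4}` absorbs `X ^ 2`, the other is at most `ε =
  -- e^{-L/4}`, so the refund on `ε` pays.
  · have huX : u ≤ X / 2 := by
      rw [hu]
      have : 6 * m / x ≤ 1 / 2 := by
        rw [div_le_div_iff₀ hx (by norm_num)]
        linarith
      nlinarith
    have hsq : X ^ 2 * Real.exp (-(X / 4)) ≤ 32 := by
      have h1 := Real.quadratic_le_exp_of_nonneg (x := X / 4) (by positivity)
      have h2 : Real.exp (X / 4) * Real.exp (-(X / 4)) = 1 := by rw [← Real.exp_add]; simp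
      have h3 : X ^ 2 ≤ 32 * Real.exp (X / 4) := by nlinarith
      calc X ^ 2 * Real.exp (-(X / 4)) ≤ 32 * Real.exp (X / 4) * Real.exp (-(X / 4)) := by gcongr
        _ = 32 := by rw [mul_assoc, h2, mul_one]
    calc 2 * (Φ * (u ^ 2 * Real.exp u))
        ≤ 2 * (Real.exp (-X) * ((6 * m / x * X) ^ 2 * Real.exp (X / 2))) := by
          rw [← hu]
          gcongr
      _ = 72 * (m / x) ^ 2 * (X ^ 2 * Real.exp (-(X / 4))) * Real.exp (-(X / 4)) := by
          have : Real.exp (-(X / 4)) * Real.exp (-(X / 4)) = Real.exp (-X) * Real.exp (X / 2) := by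
            rw [← Real.exp_add, ← Real.exp_add]
            congr 1
            ring
          linear_combination (-(72 * (m / x) ^ 2 * X ^ 2)) * this
      _ ≤ 72 * (m / x) ^ 2 * 32 * Real.exp (-(L / 4)) := by gcongr
      _ ≤ 1152 * m ^ 2 * L ^ 2 / x ^ 2 * (Real.exp (-(L / 4)) / 4) := by
          have hL2 : 4 ^ 2 ≤ L ^ 2 := by gcongr
          have := mul_le_mul_of_nonneg_left hL2
            (by positivity : 0 ≤ 288 * (m / x) ^ 2 * Real.exp (-(L / 4)))
          rw [div_pow] at *
          have h0 : 0 ≤ (m : ℝ) ^ 2 / x ^ 2 * Real.exp (-(L / 4)) := by positivity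
          calc _ = 288 * (m ^ 2 / x ^ 2) * Real.exp (-(L / 4)) * 8 := by ring
            _ ≤ 288 * (m ^ 2 / x ^ 2) * Real.exp (-(L / 4)) * 4 ^ 2 := by nlinarith
            _ ≤ _ := this
            _ = _ := by ring
      _ ≤ K / x ^ 2 * (Φ * max 0 (1 / 4 - u) + Real.exp (-(L / 4)) / 4) := by
          rw [hK]
          gcongr
          have := mul_nonneg hΦ (le_max_left 0 (1 / 4 - u))
          linarith

end Iteration

section BlockReduction

variable {n r m : ℕ} {G : Fin r → Finset (Fin n)} {M : Matrix (Fin m) (Fin n) ℝ}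
  {y z w : Fin n → ℝ} {i : Fin r}

/-! ### Reduction of the blocks -/

/-- An extreme point of the polytope has at most `m + 1` fractional entries in the block. -/
theorem card_frac_le_of_mem_extremePoints (h : z ∈ (blockPolytope G M i y).extremePoints ℝ) :
    (frac (G i) z).card ≤ m + 1 := by
  classical
  by_contra! hcard
  set S := frac (G i) z with hS
  -- If `S` had at least `m + 2` elements, these `m + 1 + (n - |S|)` linear conditions would leave a
  -- nonzero `d` supported on `S`; moving `z` a little both ways along `d` contradicts extremality.
  let f : (Fin n → ℝ) →ₗ[ℝ] (Fin m → ℝ) × ℝ × ({j // j ∉ S} → ℝ) :=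
    M.mulVecLin.prod ((∑ j ∈ G i, LinearMap.proj j).prod
      (LinearMap.pi fun j : {j // j ∉ S} => LinearMap.proj j.1))
  have hrank : Module.finrank ℝ ((Fin m → ℝ) × ℝ × ({j // j ∉ S} → ℝ)) <
      Module.finrank ℝ (Fin n → ℝ) := by
    have h1 : Fintype.card {j // j ∉ S} = n - S.card := by
      simp [Fintype.card_subtype_compl]
    have h2 : S.card ≤ n := by simpa using Finset.card_le_univ S
    simp only [Module.finrank_prod, Module.finrank_fintype_fun_eq_card, Fintype.card_fin,
      Module.finrank_self, h1]
    omega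
  obtain ⟨d, hd, hd0⟩ := (Submodule.ne_bot_iff _).1 (LinearMap.ker_ne_bot_of_finrank_lt hrank)
  have hf : f d = 0 := hd
  have hM : M.mulVec d = 0 := congrArg Prod.fst hf
  have hsum : ∑ j ∈ G i, d j = 0 := by
    simpa [f] using congrArg (fun x => x.2.1) hf
  have hoff : ∀ j, j ∉ S → d j = 0 := fun j hj => congrFun (congrArg (fun x => x.2.2) hf) ⟨j, hj⟩
  obtain ⟨⟨hz01, hzM, hzs, hzoff⟩, hext⟩ := mem_extremePoints.1 h
  have hmem : ∀ c : ℝ, (∀ j ∈ S, 0 ≤ z j + c * d j ∧ z j + c * d j ≤ 1) →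
      z + c • d ∈ blockPolytope G M i y := by
    intro c hc
    refine ⟨fun j => ?_, ?_, ?_, fun j hj => ?_⟩
    · by_cases hj : j ∈ S
      · simpa using hc j hj
      · simpa [hoff j hj] using hz01 j
    · rw [Matrix.mulVec_add, Matrix.mulVec_smul, hM, smul_zero, add_zero, hzM]
    · simp [Finset.sum_add_distrib, ← Finset.mul_sum, hsum, hzs]
    · have : j ∉ S := fun hjS => hj (mem_frac.1 hjS).1
      simp [hoff j this, hzoff j hj]
  have hev : ∀ e : ℝ, ∀ᶠ c in nhds (0 : ℝ), ∀ j ∈ S, 0 ≤ z j + e * c * d j ∧ z j + e * c * d j ≤ 1 := by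
    intro e
    rw [Filter.eventually_all_finset]
    intro j hj
    have hj' := (mem_frac.1 hj).2
    have hc : Filter.Tendsto (fun c : ℝ => z j + e * c * d j) (nhds 0) (nhds (z j)) := by
      have : Continuous fun c : ℝ => z j + e * c * d j := by fun_prop
      simpa using this.tendsto 0
    have h0 : 0 < z j := lt_of_le_of_ne (hz01 j).1 (Ne.symm hj'.1)
    have h1 : z j < 1 := lt_of_le_of_ne (hz01 j).2 hj'.2
    filter_upwards [hc.eventually (Ioo_mem_nhds h0 h1)] with c hc
    exact ⟨hc.1.le, hc.2.le⟩
  obtain ⟨c, ⟨hc1, hc2⟩, hc0⟩ := ((((hev 1).and (hev (-1))).filter_mono nhdsWithin_le_nhds).and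
    (self_mem_nhdsWithin : Set.Ioi (0 : ℝ) ∈ nhdsWithin 0 (Set.Ioi 0))).exists
  have hseg : z ∈ openSegment ℝ (z + (1 * c) • d) (z + (-1 * c) • d) :=
    ⟨1 / 2, 1 / 2, by norm_num, by norm_num, by norm_num, by
      ext j
      simp
      ring⟩
  have heq := (hext _ (hmem _ hc1) _ (hmem _ hc2) hseg).1
  rw [one_mul, add_eq_left, smul_eq_zero] at heq
  exact heq.elim (ne_of_gt hc0) hd0

theorem sum_block_eq_of_mem_blockPolytope (hG : IsPartition G) (hz : z ∈ blockPolytope G M i y)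
    (f : ℝ → Fin n → ℝ) {k : Fin r} (hk : k ≠ i) :
    ∑ j ∈ G k, f (z j) j = ∑ j ∈ G k, f (y j) j :=
  Finset.sum_congr rfl fun j hj => by
    rw [hz.2.2.2 j fun hi => hk (hG.eq_of_mem hj hi)]

theorem feasible_of_mem_blockPolytope (hG : IsPartition G) (hy : y ∈ Feasible G)
    (hz : z ∈ blockPolytope G M i y) : z ∈ Feasible G := by
  refine ⟨hz.1, fun k => ?_⟩
  rcases eq_or_ne k i with rfl | hk
  · exact hz.2.2.1
  · rw [← hy.2 k]
    exact sum_block_eq_of_mem_blockPolytope hG hz (fun x _ => x) hk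

theorem blockT_eq_of_mem_blockPolytope (hG : IsPartition G) (hz : z ∈ blockPolytope G M i y)
    {k : Fin r} (hk : k ≠ i) : blockT G z k = blockT G y k := by
  have : frac (G k) z = frac (G k) y := by
    ext j
    rw [mem_frac, mem_frac]
    refine and_congr_right fun hj => ?_
    rw [hz.2.2.2 j fun hi => hk (hG.eq_of_mem hj hi)]
  rw [blockT, blockT, this]

/-- Only the factor of block `i` varies, and it is affine in `z`, so the mean condition evaluates
its expectation exactly. -/
theorem expect_potential_reduce_le (hG : IsPartition G) (hw : ∀ j, 0 ≤ w j ∧ w j ≤ 1) {d : ℝ}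
    (hd0 : 0 ≤ d) (hd1 : d ≤ 1) (hy : y ∈ Feasible G) {p : PMF (Fin n → ℝ)}
    (hp : IsBlockReduction G M i y p) :
    expect p (fun z => ENNReal.ofReal (potential G w d z)) ≤
      ENNReal.ofReal (potential G w d y) := by
  classical
  have hpoly : ∀ z ∈ p.support, z ∈ blockPolytope G M i y := fun z hz => (hp.extreme z hz).1
  have hfeas : ∀ z ∈ p.support, z ∈ Feasible G := fun z hz =>
    feasible_of_mem_blockPolytope hG hy (hpoly z hz)
  set c := ∏ k ∈ Finset.univ.erase i, (1 - d * blockVal G w y k) with hc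
  have hsplit : ∀ z ∈ p.support, potential G w d z = (1 - d * blockVal G w z i) * c := by
    intro z hz
    rw [potential, ← Finset.mul_prod_erase _ _ (Finset.mem_univ i), hc]
    congr 1
    refine Finset.prod_congr rfl fun k hk => ?_
    have : blockVal G w z k = blockVal G w y k :=
      sum_block_eq_of_mem_blockPolytope hG (hpoly z hz) (fun x j => x * w j)
        (Finset.ne_of_mem_erase hk)
    rw [this]
  have hy' : potential G w d y = (1 - d * blockVal G w y i) * c := by
    rw [potential, ← Finset.mul_prod_erase _ _ (Finset.mem_univ i)]
  have hsum : HasSum (fun z => (p z).toReal * (1 - d * blockVal G w z i))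
      (1 - d * blockVal G w y i) := by
    have h1 : HasSum (fun z => (p z).toReal) 1 := by
      have := ENNReal.hasSum_toReal (f := p) (by simp [p.tsum_coe])
      simpa [← ENNReal.tsum_toReal_eq p.apply_ne_top, p.tsum_coe] using this
    have h2 : HasSum (fun z => ∑ j ∈ G i, (p z).toReal * z j * w j) (blockVal G w y i) :=
      hasSum_sum fun j _ => (hp.mean j).mul_right (w j)
    have h3 : ∀ z, (p z).toReal * (1 - d * blockVal G w z i) =
        (p z).toReal - d * ∑ j ∈ G i, (p z).toReal * z j * w j := fun z => by
      simp only [mul_assoc]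
      rw [← Finset.mul_sum, blockVal]
      ring
    simp only [h3]
    exact h1.sub (h2.mul_left d)
  have hterm : ∀ z, 0 ≤ (p z).toReal * (1 - d * blockVal G w z i) := fun z => by
    by_cases hz : p z = 0
    · simp [hz]
    · exact mul_nonneg ENNReal.toReal_nonneg
        (one_sub_mul_blockVal_nonneg hw hd0 hd1 (hfeas z ((p.mem_support_iff z).2 hz)) i)
  have hone : expect p (fun z => ENNReal.ofReal (1 - d * blockVal G w z i)) =
      ENNReal.ofReal (1 - d * blockVal G w y i) := by
    rw [← hsum.tsum_eq, ENNReal.ofReal_tsum_of_nonneg hterm hsum.summable, expect]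
    refine tsum_congr fun z => ?_
    rw [ENNReal.ofReal_mul ENNReal.toReal_nonneg, ENNReal.ofReal_toReal (p.apply_ne_top z)]
  have hnn := fun z hz => one_sub_mul_blockVal_nonneg (G := G) (z := z) hw hd0 hd1 hz i
  calc expect p (fun z => ENNReal.ofReal (potential G w d z))
      ≤ expect p (fun z => ENNReal.ofReal (1 - d * blockVal G w z i) * ENNReal.ofReal c) :=
        expect_mono fun z hz => by
          rw [hsplit z hz, ENNReal.ofReal_mul (hnn z (hfeas z hz))]
    _ = ENNReal.ofReal (potential G w d y) := by
        rw [expect_mul_const, hone, hy', ENNReal.ofReal_mul (hnn y hy)]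

/-- `S` records the blocks already reduced; reducing a block leaves all other blocks untouched. -/
theorem mem_of_mem_support_foldl_reduce (hG : IsPartition G) (A : Implementation G M)
    (l : List (Fin r)) (p : PMF (Fin n → ℝ)) (S : Set (Fin r))
    (hp : ∀ z ∈ p.support, z ∈ Feasible G ∧ ∀ i ∈ S, blockT G z i ≤ m) :
    ∀ z ∈ (l.foldl (fun p i => p.bind (A.reduce i)) p).support,
      z ∈ Feasible G ∧ ∀ i, i ∈ S ∨ i ∈ l → blockT G z i ≤ m := by
  induction l generalizing p S with
  | nil => simpa using hp
  | cons k l ih =>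
    intro z hz
    have := ih (p.bind (A.reduce k)) (insert k S) ?_ z hz
    · refine ⟨this.1, fun i hi => this.2 i ?_⟩
      simp only [List.mem_cons, Set.mem_insert_iff] at hi ⊢
      tauto
    · intro x hx
      rw [PMF.mem_support_bind_iff] at hx
      obtain ⟨v, hv, hx⟩ := hx
      obtain ⟨hvF, hvS⟩ := hp v hv
      have hext := (A.reduce_spec k v hvF).extreme x hx
      refine ⟨feasible_of_mem_blockPolytope hG hvF hext.1, fun i hi => ?_⟩
      rcases eq_or_ne i k with rfl | hik
      · have := card_frac_le_of_mem_extremePoints hext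
        unfold blockT
        omega
      · rw [blockT_eq_of_mem_blockPolytope hG hext.1 hik]
        exact hvS i (hi.resolve_left hik)

theorem mem_reduced_of_mem_support_intraBlockReduce (hG : IsPartition G) (A : Implementation G M)
    (hy : y ∈ Feasible G) : ∀ z ∈ (intraBlockReduce A y).support, z ∈ Reduced G m := by
  intro z hz
  have := mem_of_mem_support_foldl_reduce hG A (List.finRange r) (PMF.pure y) ∅
    (by simpa using hy) z hz
  exact ⟨this.1, fun i => this.2 i (Or.inr (List.mem_finRange i))⟩

theorem expect_potential_foldl_reduce_le (hG : IsPartition G) (hw : ∀ j, 0 ≤ w j ∧ w j ≤ 1)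
    {d : ℝ} (hd0 : 0 ≤ d) (hd1 : d ≤ 1) (A : Implementation G M)
    (l : List (Fin r)) (p : PMF (Fin n → ℝ)) (hp : ∀ z ∈ p.support, z ∈ Feasible G) :
    expect (l.foldl (fun p i => p.bind (A.reduce i)) p)
        (fun z => ENNReal.ofReal (potential G w d z)) ≤
      expect p (fun z => ENNReal.ofReal (potential G w d z)) := by
  induction l generalizing p with
  | nil => exact le_rfl
  | cons k l ih =>
    refine (ih (p.bind (A.reduce k)) ?_).trans ?_
    · intro x hx
      rw [PMF.mem_support_bind_iff] at hx
      obtain ⟨v, hv, hx⟩ := hx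
      exact feasible_of_mem_blockPolytope hG (hp v hv)
        ((A.reduce_spec k v (hp v hv)).extreme x hx).1
    · rw [expect_bind]
      exact expect_mono fun v hv =>
        expect_potential_reduce_le hG hw hd0 hd1 (hp v hv) (A.reduce_spec k v (hp v hv))

theorem expect_potential_intraBlockReduce_le (hG : IsPartition G) (hw : ∀ j, 0 ≤ w j ∧ w j ≤ 1)
    {d : ℝ} (hd0 : 0 ≤ d) (hd1 : d ≤ 1) (A : Implementation G M) (hy : y ∈ Feasible G) :
    expect (intraBlockReduce A y) (fun z => ENNReal.ofReal (potential G w d z)) ≤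
      ENNReal.ofReal (potential G w d y) :=
  (expect_potential_foldl_reduce_le hG hw hd0 hd1 A _ _ (by simpa using hy)).trans_eq
    (expect_pure _ _)

end BlockReduction

/-! ### The main loop -/

section Loop

variable {n r m t : ℕ} {G : Fin r → Finset (Fin n)} {M : Matrix (Fin m) (Fin n) ℝ}
  {y w : Fin n → ℝ}

theorem mem_reduced_of_mem_support_loopLaw (hG : IsPartition G) (A : Implementation G M)
    (hy : y ∈ Feasible G) (k : ℕ) : ∀ z ∈ (loopLaw A y t k).support, z ∈ Reduced G m := by
  induction k with
  | zero => exact mem_reduced_of_mem_support_intraBlockReduce hG A hy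
  | succ k ih =>
    intro z hz
    rw [loopLaw, PMF.mem_support_bind_iff] at hz
    obtain ⟨x, hx, hz⟩ := hz
    have hxR := ih x hx
    split_ifs at hz
    · exact mem_reduced_of_mem_support_iteration hxR (A.dir_spec k x hxR.1) z hz
    · rw [PMF.mem_support_pure_iff] at hz
      rwa [hz]

/-- Used twice: with `c < 1` for termination, and with `c = 1` for the supermartingale. -/
theorem expect_loopLaw_succ_le (hG : IsPartition G) (A : Implementation G M)
    (hy : y ∈ Feasible G) (k : ℕ) (f : (Fin n → ℝ) → ℝ≥0∞) (c : ℝ≥0∞)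
    (hf : ∀ z ∈ Reduced G m, t < totalT G z → expect (iteration G m (A.dir k z) z) f ≤ c * f z)
    (hf' : ∀ z, ¬ t < totalT G z → f z ≤ c * f z) :
    expect (loopLaw A y t (k + 1)) f ≤ c * expect (loopLaw A y t k) f := by
  rw [loopLaw, expect_bind, mul_comm, ← expect_mul_const]
  refine expect_mono fun z hz => ?_
  rw [mul_comm]
  split_ifs with h
  · exact hf z (mem_reduced_of_mem_support_loopLaw hG A hy k z hz) h
  · rw [expect_pure]
    exact hf' z h

theorem loopLaw_le_succ (A : Implementation G M) (k : ℕ) {z : Fin n → ℝ} (hz : totalT G z ≤ t) :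
    loopLaw A y t k z ≤ loopLaw A y t (k + 1) z := by
  rw [loopLaw, PMF.bind_apply]
  refine le_trans ?_ (ENNReal.le_tsum z)
  rw [if_neg hz.not_gt, PMF.pure_apply_self, mul_one]

/-- Monotone convergence: a stopped run keeps its vector, so the mass at each stopped vector only
grows with `k`. -/
theorem tsum_kpr_mul (A : Implementation G M) (F : (Fin n → ℝ) → ℝ≥0∞) :
    ∑' z, kpr A y t z * F z =
      ⨆ k, expect (loopLaw A y t k) fun z => if totalT G z ≤ t then F z else 0 := by
  unfold expect
  rw [← tsum_iSup_of_monotone]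
  · refine tsum_congr fun z => ?_
    by_cases h : totalT G z ≤ t
    · simp only [kpr, if_pos h, ENNReal.iSup_mul]
    · simp [kpr, h]
  · intro z
    refine monotone_nat_of_le_succ fun k => ?_
    by_cases h : totalT G z ≤ t
    · exact mul_le_mul' (loopLaw_le_succ A k h) le_rfl
    · simp [h]

theorem mem_reduced_of_kpr_ne_zero (hG : IsPartition G) (A : Implementation G M)
    (hy : y ∈ Feasible G) {z : Fin n → ℝ} (hz : kpr A y t z ≠ 0) : z ∈ Reduced G m := by
  rw [kpr] at hz
  split_ifs at hz
  · by_contra hzR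
    refine hz (ENNReal.iSup_eq_zero.2 fun k => ?_)
    by_contra h0
    exact hzR (mem_reduced_of_mem_support_loopLaw hG A hy k z ((PMF.mem_support_iff _ _).2 h0))
  · exact absurd rfl hz

theorem totalT_le_of_mem_reduced {z : Fin n → ℝ} (hz : z ∈ Reduced G m) :
    totalT G z ≤ r * m := by
  simpa [totalT] using Finset.sum_le_card_nsmul Finset.univ (blockT G z) m fun i _ => hz.2 i

/-- The probability that the loop is still running decays geometrically. -/
theorem expect_loopLaw_running_le (hG : IsPartition G) (A : Implementation G M)
    (hy : y ∈ Feasible G) (ht : 12 * m < t) (k : ℕ) :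
    expect (loopLaw A y t k) (fun z => if totalT G z ≤ t then 0 else 1) ≤
      ENNReal.ofReal (1 - 1 / (8 * (r * m + 1))) ^ k * ENNReal.ofReal (r * m) := by
  let f : (Fin n → ℝ) → ℝ≥0∞ := fun z => if totalT G z ≤ t then 0 else ENNReal.ofReal (totalT G z)
  have hq : (0 : ℝ) ≤ 1 - 1 / (8 * (r * m + 1)) := by
    rw [sub_nonneg, div_le_one (by positivity)]
    have : (0 : ℝ) ≤ r * m := by positivity
    linarith
  have hTle : ∀ z ∈ Reduced G m, (totalT G z : ℝ) ≤ r * m := fun z hz => by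
    exact_mod_cast totalT_le_of_mem_reduced hz
  refine (expect_mono (g := f) fun z _ => ?_).trans ?_
  · dsimp only [f]
    split_ifs with h
    · exact le_rfl
    · rw [← ENNReal.ofReal_one]
      refine ENNReal.ofReal_le_ofReal ?_
      exact_mod_cast (Nat.zero_le t).trans_lt (not_le.1 h)
  induction k with
  | zero =>
    rw [pow_zero, one_mul]
    refine expect_le_const fun z hz => ?_
    dsimp only [f]
    split_ifs
    · exact zero_le
    · exact ENNReal.ofReal_le_ofReal
        (hTle z (mem_reduced_of_mem_support_loopLaw hG A hy 0 z hz))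
  | succ k ih =>
    rw [pow_succ', mul_assoc]
    refine (expect_loopLaw_succ_le hG A hy k f _ (fun z hz hzt => ?_) fun z hz => ?_).trans
      (mul_le_mul' le_rfl ih)
    · dsimp only [f]
      rw [if_neg hzt.not_ge, ← ENNReal.ofReal_mul hq]
      refine (expect_mono fun x _ => ?_).trans
        ((expect_totalT_iteration_le hG ht hzt hz (A.dir_spec k z hz.1)).trans
          (ENNReal.ofReal_le_ofReal ?_))
      · split_ifs
        · exact zero_le
        · exact le_rfl
      · have h1 := hTle z hz
        -- As `T ≤ r * m`, the additive drop `1/8` is also a proportional one; the `+ 1` keeps the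
        -- denominator positive.
        have h2 : (totalT G z : ℝ) / (8 * (r * m + 1)) ≤ 1 / 8 := by
          rw [div_le_div_iff₀ (by positivity) (by norm_num)]
          linarith
        calc (totalT G z : ℝ) - 1 / 8 ≤ totalT G z - totalT G z / (8 * (r * m + 1)) := by linarith
          _ = _ := by ring
    · simp [f, not_lt.1 hz]

/-- The loop ends almost surely. -/
theorem tsum_kpr_eq_one (hG : IsPartition G) (A : Implementation G M) (hy : y ∈ Feasible G)
    (ht : 12 * m < t) : ∑' z, kpr A y t z = 1 := by
  have h := tsum_kpr_mul (t := t) (y := y) A fun _ => 1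
  simp only [mul_one] at h
  rw [h]
  refine le_antisymm (iSup_le fun k => expect_le_const fun z _ => ?_) ?_
  · split_ifs <;> simp
  have hlim : Filter.Tendsto (fun k : ℕ =>
      (⨆ k, expect (loopLaw A y t k) fun z => if totalT G z ≤ t then 1 else 0) +
        ENNReal.ofReal (1 - 1 / (8 * (r * m + 1))) ^ k * ENNReal.ofReal (r * m)) Filter.atTop
      (nhds ((⨆ k, expect (loopLaw A y t k) fun z => if totalT G z ≤ t then 1 else 0) +
        0 * ENNReal.ofReal (r * m))) := by
    refine tendsto_const_nhds.add (ENNReal.Tendsto.mul_const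
      (ENNReal.tendsto_pow_atTop_nhds_zero_of_lt_one ?_) (Or.inr ENNReal.ofReal_ne_top))
    rw [ENNReal.ofReal_lt_one]
    have : (0 : ℝ) < 1 / (8 * (r * m + 1)) := by positivity
    linarith
  rw [zero_mul, add_zero] at hlim
  refine ge_of_tendsto' hlim fun k => ?_
  calc (1 : ℝ≥0∞) = expect (loopLaw A y t k) (fun z =>
        (if totalT G z ≤ t then 1 else 0) + if totalT G z ≤ t then 0 else 1) := by
        refine (expect_const (loopLaw A y t k) 1).symm.trans (congrArg _ (funext fun z => ?_))
        split_ifs <;> simp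
    _ ≤ _ := by
        rw [expect_add]
        exact add_le_add
          (le_iSup (fun k => expect (loopLaw A y t k) fun z => if totalT G z ≤ t then 1 else 0) k)
          (expect_loopLaw_running_le hG A hy ht k)

theorem expect_weightedPotential_loopLaw_le (hG : IsPartition G)
    (hw : ∀ j, 0 ≤ w j ∧ w j ≤ 1) {d L : ℝ} (hd0 : 0 ≤ d) (hd1 : d ≤ 1) (hL : 4 ≤ L)
    (ht : 12 * m < t) (htL : 48 * m * L ≤ t) (A : Implementation G M) (hy : y ∈ Feasible G)
    (k : ℕ) :
    expect (loopLaw A y t k) (fun z => ENNReal.ofReal (weightedPotential G w d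
        (Real.exp (-(L / 4))) (1152 * m ^ 2 * L ^ 2) t z)) ≤
      ENNReal.ofReal ((potential G w d y + Real.exp (-(L / 4))) *
        Real.exp (1152 * m ^ 2 * L ^ 2 / t)) := by
  have hK : (0 : ℝ) ≤ 1152 * m ^ 2 * L ^ 2 := by positivity
  have hε := (Real.exp_pos (-(L / 4))).le
  have ht0 : 0 < t := (Nat.zero_le _).trans_lt ht
  induction k with
  | zero =>
    rw [loopLaw, ENNReal.ofReal_mul (add_nonneg (potential_nonneg hw hd0 hd1 hy) hε),
      ENNReal.ofReal_add (potential_nonneg hw hd0 hd1 hy) hε]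
    calc _ ≤ expect (intraBlockReduce A y) (fun z => (ENNReal.ofReal (potential G w d z) +
            ENNReal.ofReal (Real.exp (-(L / 4)))) *
              ENNReal.ofReal (Real.exp (1152 * m ^ 2 * L ^ 2 / t))) := by
          refine expect_mono fun z hz => ?_
          have hzF := (mem_reduced_of_mem_support_intraBlockReduce hG A hy z hz).1
          have hΦ := potential_nonneg hw hd0 hd1 hzF
          rw [← ENNReal.ofReal_add hΦ hε, ← ENNReal.ofReal_mul (add_nonneg hΦ hε)]
          exact ENNReal.ofReal_le_ofReal
            (mul_le_mul_of_nonneg_left (levelWeight_le hK ht0 _) (add_nonneg hΦ hε))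
      _ ≤ _ := by
          rw [expect_mul_const, expect_add, expect_const]
          gcongr
          exact expect_potential_intraBlockReduce_le hG hw hd0 hd1 A hy
  | succ k ih =>
    refine le_trans ?_ ih
    have := expect_loopLaw_succ_le (t := t) hG A hy k (fun z => ENNReal.ofReal
      (weightedPotential G w d (Real.exp (-(L / 4))) (1152 * m ^ 2 * L ^ 2) t z)) 1
      (fun z hz hzt => ?_) fun z _ => by rw [one_mul]
    · rwa [one_mul] at this
    · rw [one_mul]
      exact expect_weightedPotential_iteration_le hG hw hd0 hd1 hε hK ht hzt hz
        (A.dir_spec k z hz.1) rfl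
        (potential_increment_le hG hw hd0 hd1 hL ht htL hzt hz.1 rfl rfl)

/-- The expected potential of the output of KPR. -/
theorem tsum_kpr_mul_potential_le (hG : IsPartition G) (hw : ∀ j, 0 ≤ w j ∧ w j ≤ 1) {d : ℝ}
    (hd0 : 0 ≤ d) (hd1 : d ≤ 1) (ht : 12 * m < t) (A : Implementation G M)
    (hy : y ∈ Feasible G) :
    ∑' z, kpr A y t z * ENNReal.ofReal (potential G w d z) ≤
      ENNReal.ofReal (Real.exp (36864 * ((m : ℝ) ^ 2 * (1 + d * (y ⬝ᵥ w)) ^ 3 / t)) *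
        Real.exp (-(d * (y ⬝ᵥ w)))) := by
  have hX : 0 ≤ d * (y ⬝ᵥ w) :=
    mul_nonneg hd0 (Finset.sum_nonneg fun j _ => mul_nonneg (hy.1 j).1 (hw j).1)
  have ht0 : (0 : ℝ) < t := by exact_mod_cast (Nat.zero_le _).trans_lt ht
  have hm0 : (0 : ℝ) ≤ m := Nat.cast_nonneg m
  have hΦy := potential_le_exp hG hw hd0 hd1 hy
  -- The cutoff is `L = 4 (1 + X)`, giving `ε = e^{-(1+X)} ≤ e^{-X}`.
  rcases le_or_gt (48 * m * (4 * (1 + d * (y ⬝ᵥ w)))) (t : ℝ) with htL | htL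
  · rw [tsum_kpr_mul]
    refine iSup_le fun k => ?_
    have hloop := expect_weightedPotential_loopLaw_le hG hw hd0 hd1 (by linarith) ht htL A hy k
    set X := d * (y ⬝ᵥ w)
    have hε := (Real.exp_pos (-(4 * (1 + X) / 4))).le
    have hK : (0 : ℝ) ≤ 1152 * m ^ 2 * (4 * (1 + X)) ^ 2 := by positivity
    have h1 : expect (loopLaw A y t k) (fun z => if totalT G z ≤ t then
          ENNReal.ofReal (potential G w d z) else 0) +
        ENNReal.ofReal (Real.exp (-(4 * (1 + X) / 4))) ≤
        ENNReal.ofReal ((potential G w d y + Real.exp (-(4 * (1 + X) / 4))) *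
          Real.exp (1152 * m ^ 2 * (4 * (1 + X)) ^ 2 / t)) := by
      refine le_trans ?_ hloop
      rw [← expect_const (loopLaw A y t k) (ENNReal.ofReal _), ← expect_add]
      refine expect_mono fun z hz => ?_
      have hΦ := potential_nonneg hw hd0 hd1
        (mem_reduced_of_mem_support_loopLaw hG A hy k z hz).1
      calc _ ≤ ENNReal.ofReal (potential G w d z) +
              ENNReal.ofReal (Real.exp (-(4 * (1 + X) / 4))) := by
            gcongr
            split_ifs
            · exact le_rfl
            · exact zero_le
        _ ≤ _ := by
            rw [← ENNReal.ofReal_add hΦ hε]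
            exact ENNReal.ofReal_le_ofReal
              (le_mul_of_one_le_right (add_nonneg hΦ hε) (one_le_levelWeight hK t _))
    -- Keeping `ε` on the left and subtracting it avoids a factor `2`: with `s = e^x` the bound is
    -- `(2 s - 1) e^{-X}`, and `2 s - 1 ≤ s²`.
    have h2 := ENNReal.le_sub_of_add_le_right ENNReal.ofReal_ne_top h1
    rw [← ENNReal.ofReal_sub _ hε] at h2
    refine h2.trans (ENNReal.ofReal_le_ofReal ?_)
    set x := 1152 * (m : ℝ) ^ 2 * (4 * (1 + X)) ^ 2 / t with hx
    have hx1 : 1 ≤ Real.exp x := Real.one_le_exp (by positivity)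
    have hεX : Real.exp (-(4 * (1 + X) / 4)) ≤ Real.exp (-X) := Real.exp_le_exp.2 (by linarith)
    have h3 : 2 * x ≤ 36864 * ((m : ℝ) ^ 2 * (1 + X) ^ 3 / t) := by
      calc 2 * x = 36864 * ((m : ℝ) ^ 2 * (1 + X) ^ 2 / t) := by rw [hx]; ring
        _ ≤ 36864 * ((m : ℝ) ^ 2 * (1 + X) ^ 3 / t) := by
            gcongr
            · linarith
            · norm_num
    calc (potential G w d y + Real.exp (-(4 * (1 + X) / 4))) * Real.exp x -
          Real.exp (-(4 * (1 + X) / 4))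
        ≤ (Real.exp (-X) + Real.exp (-X)) * Real.exp x - Real.exp (-X) := by
          nlinarith
      _ ≤ (Real.exp x) ^ 2 * Real.exp (-X) := by
          nlinarith [mul_nonneg (sq_nonneg (Real.exp x - 1)) (Real.exp_pos (-X)).le]
      _ = Real.exp (2 * x) * Real.exp (-X) := by
          rw [two_mul x, Real.exp_add]
          ring
      _ ≤ _ := by gcongr
  -- For small `t` the trivial bound `Φ ≤ 1` is enough, since the error exponent is at least `X`.
  · set X := d * (y ⬝ᵥ w)
    have hmpos : (0 : ℝ) < m := by
      rcases hm0.eq_or_lt with h | h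
      · rw [← h] at htL
        norm_num at htL
        linarith
      · exact h
    have hm1 : (1 : ℝ) ≤ m := by
      have : 0 < m := by exact_mod_cast hmpos
      exact_mod_cast this
    calc ∑' z, kpr A y t z * ENNReal.ofReal (potential G w d z)
        ≤ ∑' z, kpr A y t z := by
          refine ENNReal.tsum_le_tsum fun z => ?_
          by_cases hz : kpr A y t z = 0
          · simp [hz]
          · have hzF := (mem_reduced_of_kpr_ne_zero hG A hy hz).1
            refine mul_le_of_le_one_right' ?_
            rw [ENNReal.ofReal_le_one]
            exact Finset.prod_le_one
              (fun i _ => one_sub_mul_blockVal_nonneg hw hd0 hd1 hzF i)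
              fun i _ => by linarith [mul_nonneg hd0 (blockVal_nonneg hw hzF i)]
      _ = 1 := tsum_kpr_eq_one hG A hy ht
      _ ≤ _ := by
          rw [ENNReal.one_le_ofReal, ← Real.exp_add]
          apply Real.one_le_exp
          have h1 : X ≤ 36864 * ((m : ℝ) ^ 2 * (1 + X) ^ 3 / t) := by
            rw [← mul_div_assoc, le_div_iff₀ ht0]
            calc X * t ≤ X * (48 * m * (4 * (1 + X))) := by gcongr
              _ = 192 * (m * 1) * (1 + X) * X := by ring
              _ ≤ 192 * (m * m) * (1 + X) * (1 + X) ^ 2 := by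
                  gcongr
                  nlinarith
              _ = 192 * (m ^ 2 * (1 + X) ^ 3) := by ring
              _ ≤ _ := by gcongr; norm_num
          linarith

end Loop

/-! ### Independent selection -/

section Selection

variable {n r m t : ℕ} {G : Fin r → Finset (Fin n)} {M : Matrix (Fin m) (Fin n) ℝ}
  {y z w : Fin n → ℝ}

/-- Disjoint blocks make `s` injective, so no item is counted twice. -/
theorem selected_dotProduct (hG : IsPartition G) {s : Fin r → Fin n}
    (hs : s ∈ Fintype.piFinset G) (w : Fin n → ℝ) : selected s ⬝ᵥ w = ∑ i, w (s i) := by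
  classical
  have hinj : Function.Injective s := fun i k hik =>
    hG.eq_of_mem (Fintype.mem_piFinset.1 hs i) (hik ▸ Fintype.mem_piFinset.1 hs k)
  rw [← Finset.sum_image (f := w) (s := Finset.univ) (g := s) fun i _ k _ h => hinj h]
  simp only [dotProduct, selected, ite_mul, one_mul, zero_mul, ← Finset.sum_filter]
  refine Finset.sum_congr ?_ fun _ _ => rfl
  ext j
  simp

theorem tsum_indicator_indSelect (z : Fin n → ℝ) (E : Set (Fin n → ℝ)) :
    ∑' Y, E.indicator (indSelect G z) Y = ∑ s ∈ Fintype.piFinset G,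
      (∏ i, ENNReal.ofReal (z (s i))) * E.indicator 1 (selected s) := by
  classical
  have h : ∀ Y, E.indicator (indSelect G z) Y = ∑ s ∈ Fintype.piFinset G,
      if Y = selected s then (∏ i, ENNReal.ofReal (z (s i))) * E.indicator 1 Y else 0 := by
    intro Y
    by_cases hY : Y ∈ E
    · simp [indSelect, hY, eq_comm]
    · simp [hY]
  simp only [h]
  rw [Summable.tsum_finsetSum fun _ _ => ENNReal.summable]
  exact Finset.sum_congr rfl fun s _ => tsum_ite_eq _ _

theorem tsum_indicator_indSelect_univ (hz : z ∈ Feasible G) :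
    ∑' Y, Set.univ.indicator (indSelect G z) Y = 1 := by
  rw [tsum_indicator_indSelect]
  simp only [Set.indicator_univ, Pi.one_apply, mul_one]
  rw [← Finset.prod_univ_sum G fun _ j => ENNReal.ofReal (z j)]
  refine Finset.prod_eq_one fun i _ => ?_
  rw [← ENNReal.ofReal_sum_of_nonneg fun j _ => (hz.1 j).1, hz.2 i, ENNReal.ofReal_one]

/-- Markov's inequality for `(1-d)^(Y·w)`, whose mean factors over the blocks. The event is stated
for a larger weight `w'` so that `w` can be rescaled later. At `d = 1` the prefactor is `0^0 = 1`.
-/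
theorem tsum_indicator_indSelect_le (hG : IsPartition G) (hw : ∀ j, 0 ≤ w j ∧ w j ≤ 1)
    {w' : Fin n → ℝ} (hww' : ∀ j, w j ≤ w' j) {d μ : ℝ} (hd1 : d ≤ 1) (hd0 : 0 ≤ d)
    (hz : z ∈ Feasible G) :
    ∑' Y, {Y | Y ⬝ᵥ w' ≤ μ * (1 - d)}.indicator (indSelect G z) Y ≤
      ENNReal.ofReal (((1 - d) ^ (μ * (1 - d)))⁻¹ * potential G w d z) := by
  have hd : 0 ≤ 1 - d := by linarith
  have hpow : 0 ≤ (1 - d) ^ (μ * (1 - d)) := Real.rpow_nonneg hd _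
  have hpos : 0 < (1 - d) ^ (μ * (1 - d)) := by
    rcases hd.eq_or_lt with h | h
    · rw [← h]; simp
    · exact Real.rpow_pos_of_pos h _
  rw [tsum_indicator_indSelect]
  calc _ ≤ ∑ s ∈ Fintype.piFinset G, ENNReal.ofReal (((1 - d) ^ (μ * (1 - d)))⁻¹) *
        ∏ i, ENNReal.ofReal (z (s i) * (1 - d) ^ w (s i)) := by
        refine Finset.sum_le_sum fun s hs => ?_
        simp only [ENNReal.ofReal_mul (hz.1 _).1, Finset.prod_mul_distrib]
        rw [mul_left_comm]
        refine mul_le_mul_right ?_ _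
        by_cases hE : selected s ∈ {Y | Y ⬝ᵥ w' ≤ μ * (1 - d)}
        · rw [Set.indicator_of_mem hE, Pi.one_apply,
            ← ENNReal.ofReal_prod_of_nonneg fun i _ => Real.rpow_nonneg hd _,
            ← Real.rpow_sum_of_nonneg hd fun i _ => (hw (s i)).1,
            ← ENNReal.ofReal_mul (inv_nonneg.2 hpow), ENNReal.one_le_ofReal,
            ← div_eq_inv_mul, one_le_div hpos]
          have hE' : ∑ i, w' (s i) ≤ μ * (1 - d) := by
            rw [← selected_dotProduct hG hs]
            exact hE
          exact Real.rpow_le_rpow_of_exponent_ge' hd (by linarith)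
            (Finset.sum_nonneg fun i _ => (hw (s i)).1)
            ((Finset.sum_le_sum fun i _ => hww' (s i)).trans hE')
        · rw [Set.indicator_of_notMem hE]
          exact zero_le
    _ = ENNReal.ofReal (((1 - d) ^ (μ * (1 - d)))⁻¹) *
        ∏ i, ENNReal.ofReal (∑ j ∈ G i, z j * (1 - d) ^ w j) := by
        rw [← Finset.mul_sum,
          ← Finset.prod_univ_sum G fun _ j => ENNReal.ofReal (z j * (1 - d) ^ w j)]
        congr 1
        refine Finset.prod_congr rfl fun i _ => ?_
        rw [ENNReal.ofReal_sum_of_nonneg fun j _ =>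
          mul_nonneg (hz.1 j).1 (Real.rpow_nonneg hd _)]
    _ ≤ _ := by
        rw [ENNReal.ofReal_mul (inv_nonneg.2 hpow), potential,
          ENNReal.ofReal_prod_of_nonneg fun i _ =>
            one_sub_mul_blockVal_nonneg hw hd0 hd1 hz i]
        gcongr with i
        calc ∑ j ∈ G i, z j * (1 - d) ^ w j ≤ ∑ j ∈ G i, (z j - d * (z j * w j)) := by
              refine Finset.sum_le_sum fun j _ => ?_
              have h := rpow_one_add_le_one_add_mul_self (s := -d) (by linarith)
                (hw j).1 (hw j).2
              rw [← sub_eq_add_neg] at h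
              have := mul_le_mul_of_nonneg_left h (hz.1 j).1
              linarith
          _ = 1 - d * blockVal G w z i := by
              rw [Finset.sum_sub_distrib, hz.2 i, ← Finset.mul_sum, blockVal]

theorem prob_fullKPR (A : Implementation G M) (y : Fin n → ℝ) (t : ℕ) (E : Set (Fin n → ℝ)) :
    prob (fullKPR A y t) E =
      ∑' z, kpr A y t z * ∑' Y, E.indicator (indSelect G z) Y := by
  simp only [← ENNReal.tsum_mul_left]
  rw [ENNReal.tsum_comm, prob]
  refine tsum_congr fun Y => ?_
  by_cases hY : Y ∈ E
  · simp [hY, fullKPR]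
  · simp [hY]

end Selection

end KPR

end

theorem mainTheorem12 :
    ∃ C : ℝ, 0 < C ∧
      ∀ (n r m t : ℕ) (G : Fin r → Finset (Fin n)) (M : Matrix (Fin m) (Fin n) ℝ)
        (y w : Fin n → ℝ) (μ δ : ℝ) (A : KPR.Implementation G M),
        KPR.IsPartition G → (∀ k j, 0 ≤ M k j) → y ∈ KPR.Feasible G → 12 * m < t →
        (∀ j, 0 ≤ w j ∧ w j ≤ 1) → 1 ≤ μ → μ ≤ y ⬝ᵥ w → 0 ≤ δ → δ ≤ 1 →
        -- the algorithm ends almost surely, so that its output has a probability law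
        KPR.prob (KPR.fullKPR A y t) Set.univ = 1 ∧
        KPR.prob (KPR.fullKPR A y t) {Y | Y ⬝ᵥ w ≤ μ * (1 - δ)} ≤
          ENNReal.ofReal
            (Real.exp (C * ((m : ℝ) ^ 2 * (1 + δ * μ) ^ 3 / (t : ℝ))) *
              (Real.exp (-δ) / (1 - δ) ^ (1 - δ)) ^ μ) := by
  -- `36864 = 2 * 1152 * 4²`: twice `K / t` at `L = 4 (1 + X)`.
  refine ⟨36864, by norm_num, ?_⟩
  intro n r m t G M y w μ δ A hG _ hy ht hw hμ1 hμ hδ0 hδ1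
  rw [KPR.prob_fullKPR, KPR.prob_fullKPR]
  constructor
  · rw [← KPR.tsum_kpr_eq_one hG A hy ht]
    refine tsum_congr fun z => ?_
    by_cases hz : KPR.kpr A y t z = 0
    · simp [hz]
    · rw [KPR.tsum_indicator_indSelect_univ (KPR.mem_reduced_of_kpr_ne_zero hG A hy hz).1, mul_one]
  · have hyw : 0 < y ⬝ᵥ w := by linarith
    have hc0 : 0 ≤ μ / (y ⬝ᵥ w) := by positivity
    have hc1 : μ / (y ⬝ᵥ w) ≤ 1 := (div_le_one hyw).2 hμ
    -- Scaling `w` down to mean exactly `μ` puts `δ * μ`, not `δ * (y ⬝ᵥ w)`, into the error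
    -- exponent; the event for `w` implies the one for `v`.
    set v : Fin n → ℝ := (μ / (y ⬝ᵥ w)) • w with hv
    have hvw : ∀ j, v j ≤ w j := fun j => mul_le_of_le_one_left (hw j).1 hc1
    have hv01 : ∀ j, 0 ≤ v j ∧ v j ≤ 1 := fun j =>
      ⟨mul_nonneg hc0 (hw j).1, (hvw j).trans (hw j).2⟩
    have hyv : y ⬝ᵥ v = μ := by
      rw [hv, dotProduct_smul, smul_eq_mul, div_mul_cancel₀ _ hyw.ne']
    have hd : 0 ≤ 1 - δ := by linarith
    have hD : 0 ≤ ((1 - δ) ^ (μ * (1 - δ)))⁻¹ := inv_nonneg.2 (Real.rpow_nonneg hd _)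
    calc _ ≤ ∑' z, KPR.kpr A y t z * ENNReal.ofReal (KPR.potential G v δ z) *
          ENNReal.ofReal (((1 - δ) ^ (μ * (1 - δ)))⁻¹) := by
          refine ENNReal.tsum_le_tsum fun z => ?_
          by_cases hz : KPR.kpr A y t z = 0
          · simp [hz]
          · rw [mul_assoc, mul_comm (ENNReal.ofReal (KPR.potential G v δ z)),
              ← ENNReal.ofReal_mul hD]
            exact mul_le_mul' le_rfl (KPR.tsum_indicator_indSelect_le hG hv01 hvw hδ1 hδ0
              (KPR.mem_reduced_of_kpr_ne_zero hG A hy hz).1)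
      _ ≤ ENNReal.ofReal (Real.exp (36864 * ((m : ℝ) ^ 2 * (1 + δ * μ) ^ 3 / t)) *
            Real.exp (-(δ * μ))) * ENNReal.ofReal (((1 - δ) ^ (μ * (1 - δ)))⁻¹) := by
          rw [ENNReal.tsum_mul_right]
          have := KPR.tsum_kpr_mul_potential_le hG hv01 hδ0 hδ1 ht A hy
          rw [hyv] at this
          exact mul_le_mul' this le_rfl
      _ = _ := by
          rw [← ENNReal.ofReal_mul (by positivity)]
          congr 1
          rw [Real.div_rpow (Real.exp_pos _).le (Real.rpow_nonneg hd _), ← Real.exp_mul,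
            ← Real.rpow_mul hd, mul_comm (1 - δ) μ, neg_mul, mul_assoc,
            div_eq_mul_inv (Real.exp (-(δ * μ)))]
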